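/- Let $\sigma\neq 0$ and $\theta$ be real numbers and let $(\lambda_n)_{n\ge 1}$ be a sequence of positive real numbers with $$r_\infty:=\sum_{n=1}^\infty n\,\lambda_n^{-2\theta}<\infty .$$ Put $r_n:=\sum_{j=n}^\infty\lambda_j^{-2\theta}$ for $n\ge 1$. Let $(\eta_t)_{t\ge0}$ be the minimal birth–death process on the positive integers started at $\eta_0=1$, with birth rates $\nu_j=\sigma^2\lambda_j^{2\theta}$ ($j\ge1$), death rates $\mu_j=\sigma^2\lambda_{j-1}^{2\theta}$ ($j\ge2$), and $\mu_1=0$: it waits in each visited state $j$ for an exponential time of rate $\mu_j+\nu_j$, then jumps to $j+1$ with probability $\nu_j/(\mu_j+\nu_j)$ and to $j-1$ with probability $\mu_j/(\mu_j+\nu_j)$, and it is sent to a cemetery state at the explosion time $\tau\in[0,\infty]$, the limit of its jump times. Let $T_n$ be the Lebesgue measure of $\{t\ge 0:\eta_t=n\}$. Then for every $n\ge1$, $T_n$ is an exponential random variable with mean $\sigma^{-2}r_n$; in particular $$\mathbb E(\tau)=\sigma^{-2}\sum_{n=1}^\infty r_n=\sigma^{-2}\sum_{n=1}^\infty n\,\lambda_n^{-2\theta}=\sigma^{-2}r_\infty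 .$$ Moreover, there exists $\alpha>0$, depending only on $\theta$ and $(\lambda_n)_{n\ge1}$, such that for all $t\ge0$ $$\exp\Big(-\frac{\sigma^2 t}{r_1}\Big)\le\mathbb P(\tau>t)\le\exp\Big(-\frac{\sigma^2 t}{r_\infty}+\alpha\Big).$$ -/

import Mathlib

open MeasureTheory ProbabilityTheory

noncomputable section

namespace BirthDeath

/-- The birth rates `ν_j = σ² λ_j^{2θ}` (rate of `j → j + 1`, for states `j ≥ 1`). -/
def birthRate (σ : ℝ) (lam : ℕ → ℝ) (θ : ℝ) (j : ℕ) : ℝ :=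
  σ ^ 2 * lam j ^ (2 * θ)

/-- The death rates `μ_j = σ² λ_{j-1}^{2θ}` (rate of `j → j - 1`) for `j ≥ 2`, and `μ_1 = 0`:
the states are the positive integers, so there is no death in state `1`. -/
def deathRate (σ : ℝ) (lam : ℕ → ℝ) (θ : ℝ) (j : ℕ) : ℝ :=
  if j ≤ 1 then 0 else σ ^ 2 * lam (j - 1) ^ (2 * θ)

/-- The jump probabilities `Π_{j,j+1} = ν_j / (μ_j + ν_j)`, `Π_{j,j-1} = μ_j / (μ_j + ν_j)` of the
birth-death chain with birth rates `ν` and death rates `μ`. -/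
def jumpProb (ν μ : ℕ → ℝ) (i j : ℕ) : ℝ :=
  if j = i + 1 then ν i / (μ i + ν i) else if j + 1 = i then μ i / (μ i + ν i) else 0

/-- A minimal birth-death process started at `x₀`, with birth rates `ν` and death rates `μ`, on the
probability space `(Ω, P)`, given by its successive states `state k` (the embedded jump chain) and
the successive waiting times `hold k` in these states. The joint law says that `state` is a
Markov chain started at `x₀` with transition probabilities `jumpProb ν μ`, and that, given the
whole chain, the waiting times are independent, `hold k` being exponential with rate
`μ + ν` taken at `state k`. -/
structure MinimalProcess (ν μ : ℕ → ℝ) (x₀ : ℕ) {Ω : Type*} [MeasurableSpace Ω]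
    (P : Measure Ω) where
  state : ℕ → Ω → ℕ
  hold : ℕ → Ω → ℝ
  measurable_state : ∀ k, Measurable (state k)
  measurable_hold : ∀ k, Measurable (hold k)
  joint_law : ∀ (n : ℕ) (i : ℕ → ℕ) (s : ℕ → ℝ), (∀ k, 0 ≤ s k) →
    P.real {ω | ∀ k ≤ n, state k ω = i k ∧ s k < hold k ω} =
      (if i 0 = x₀ then 1 else 0) *
        (∏ k ∈ Finset.range n, jumpProb ν μ (i k) (i (k + 1))) *
        ∏ k ∈ Finset.range (n + 1), Real.exp (-((μ (i k) + ν (i k)) * s k))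

namespace MinimalProcess

variable {ν μ : ℕ → ℝ} {x₀ : ℕ} {Ω : Type*} [MeasurableSpace Ω] {P : Measure Ω}

/-- The time of the `k`-th jump (`0` for `k = 0`). -/
def jumpTime (X : MinimalProcess ν μ x₀ P) (k : ℕ) (ω : Ω) : ℝ :=
  ∑ l ∈ Finset.range k, X.hold l ω

open Classical in
/-- The process `η_t`: it equals `state k` between the `k`-th and the `(k+1)`-st jump, and sits in
the cemetery `⊤` from the time on at which infinitely many jumps have occurred. -/
def eta (X : MinimalProcess ν μ x₀ P) (t : ℝ) (ω : Ω) : WithTop ℕ :=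
  if h : ∃ k, X.jumpTime k ω ≤ t ∧ t < X.jumpTime (k + 1) ω then
    ((X.state (Nat.find h) ω : ℕ) : WithTop ℕ)
  else ⊤

/-- The total time `T_n`, i.e. the Lebesgue measure of `{t ≥ 0 : η_t = n}`. -/
def totalTime (X : MinimalProcess ν μ x₀ P) (n : ℕ) (ω : Ω) : ENNReal :=
  volume {t : ℝ | 0 ≤ t ∧ X.eta t ω = (n : WithTop ℕ)}

/-- The explosion time `τ ∈ [0, ∞]`: the supremum of the jump times. -/
def explosionTime (X : MinimalProcess ν μ x₀ P) (ω : Ω) : ENNReal :=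
  ⨆ k, ENNReal.ofReal (X.jumpTime k ω)

end MinimalProcess

/-- `r_n = ∑_{j ≥ n} λ_j^{-2θ}`. -/
def tailSum (lam : ℕ → ℝ) (θ : ℝ) (n : ℕ) : ℝ :=
  ∑' j : ℕ, lam (n + j) ^ (-(2 * θ))

/-- `r_∞ = ∑_{n ≥ 1} n λ_n^{-2θ}` (the term for `n = 0` vanishes). -/
def rInf (lam : ℕ → ℝ) (θ : ℝ) : ℝ :=
  ∑' n : ℕ, (n : ℝ) * lam n ^ (-(2 * θ))

end BirthDeath

end

/-! Write `a j` for `λ_j^{-2θ}`, `c` for `σ²` and `L f x = ν x (f (x+1) - f x) + μ x (f (x-1) - f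
x)` for the generator. The rate across the edge `{j, j+1}` is `c / a j` in both directions, so `L`
is symmetric, with edge resistances `a j / c`. Its potentials are explicit: `x ↦ r_{max x n}`
satisfies `L f = -c · 1_{x = n}` (`generator_tail_max`).

If `L f = -V f`, then `exp(∑ V(state) · hold) · f(state)` has constant expectation along the jumps;
for a supersolution the expectation does not increase (`lintegral_exp_mul_eq`,
`lintegral_exp_mul_le`). Three choices of `V` and `f` carry the proof.

With `V = 0` and `f` the potential of `n`, the expected number of visits to `n` is finite, so the
chain tends to infinity (`ae_tendsto_state`). With `V = s · 1_{x = n}` and `f = 1 + s r_{max x n} /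
(c - s r_n)`, which tends to `1` at infinity, the limit gives `E exp(s T_n) = f 1 = c / (c - s r_n)`
for small `s`. This is the transform of the exponential law of rate `c / r_n`, which it determines
(`ext_of_lintegral_exp`). Since `τ = ∑ T_n`, the mean of `τ` follows by summation by parts, and the
lower bound follows from `τ ≥ T_1`. With `V = c / r_∞` and a supersolution bounded below by `b > 0`
(`exists_supersolution`), Markov's inequality gives the upper bound with prefactor `f 1 / b`. -/

namespace BirthDeath

/-! ### Exponential laws, determination of a law by its moment generating function, and product
integrals. -/

lemma expMeasure_Ioi {q s : ℝ} (hq : 0 < q) (hs : 0 ≤ s) :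
    expMeasure q (Set.Ioi s) = ENNReal.ofReal (Real.exp (-(q * s))) := by
  have := isProbabilityMeasure_expMeasure hq
  have h := cdf_expMeasure_eq hq s
  rw [cdf_eq_real, if_pos hs] at h
  rw [← Set.compl_Iic, ← ofReal_measureReal, probReal_compl_eq_one_sub measurableSet_Iic, h]
  congr 1; ring

lemma expMeasure_Ioi_of_neg {q s : ℝ} (hq : 0 < q) (hs : s ≤ 0) :
    expMeasure q (Set.Ioi s) = 1 := by
  have := isProbabilityMeasure_expMeasure hq
  refine le_antisymm prob_le_one ?_
  calc (1 : ENNReal) = expMeasure q (Set.Ioi 0) := by simp [expMeasure_Ioi hq le_rfl]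
    _ ≤ _ := measure_mono (Set.Ioi_subset_Ioi hs)

/-- Tilting the exponential density of rate `q` by `exp (s x)` gives `q / (q - s)` times the
exponential density of rate `q - s`. -/
lemma lintegral_exp_expMeasure {q s : ℝ} (hq : 0 < q) (hs : s < q) :
    ∫⁻ x, ENNReal.ofReal (Real.exp (s * x)) ∂expMeasure q = ENNReal.ofReal (q / (q - s)) := by
  have hqs : 0 < q - s := sub_pos.2 hs
  have hm : Measurable (exponentialPDF q) := (measurable_exponentialPDFReal q).ennreal_ofReal
  have hm' : Measurable (exponentialPDF (q - s)) :=
    (measurable_exponentialPDFReal (q - s)).ennreal_ofReal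
  change ∫⁻ x, _ ∂(volume.withDensity (exponentialPDF q)) = _
  rw [lintegral_withDensity_eq_lintegral_mul _ hm (by fun_prop)]
  calc _ = ∫⁻ x, ENNReal.ofReal (q / (q - s)) * exponentialPDF (q - s) x := by
        refine lintegral_congr fun x => ?_
        simp only [Pi.mul_apply]
        rcases lt_or_ge x 0 with hx | hx
        · simp [exponentialPDF_of_neg hx]
        · rw [exponentialPDF_of_nonneg hx, exponentialPDF_of_nonneg hx,
            ← ENNReal.ofReal_mul (by positivity), ← ENNReal.ofReal_mul (by positivity),
            mul_assoc, ← Real.exp_add]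
          congr 1
          field_simp
          congr 1; ring
    _ = _ := by
        rw [lintegral_const_mul _ hm', lintegral_exponentialPDF_eq_one hqs, mul_one]

/-- Multiplying the exponential density by `x` gives `1 / q` times the Gamma density of shape `2`.
-/
lemma lintegral_id_expMeasure {q : ℝ} (hq : 0 < q) :
    ∫⁻ x, ENNReal.ofReal x ∂expMeasure q = ENNReal.ofReal (1 / q) := by
  have hm : Measurable (exponentialPDF q) := (measurable_exponentialPDFReal q).ennreal_ofReal
  have hm' : Measurable (gammaPDF 2 q) := (measurable_gammaPDFReal 2 q).ennreal_ofReal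
  change ∫⁻ x, _ ∂(volume.withDensity (exponentialPDF q)) = _
  rw [lintegral_withDensity_eq_lintegral_mul _ hm (by fun_prop)]
  calc _ = ∫⁻ x, ENNReal.ofReal (1 / q) * gammaPDF 2 q x := by
        refine lintegral_congr fun x => ?_
        simp only [Pi.mul_apply]
        rcases lt_or_ge x 0 with hx | hx
        · simp [exponentialPDF_of_neg hx, gammaPDF_of_neg hx]
        · rw [exponentialPDF_of_nonneg hx, gammaPDF_of_nonneg hx,
            ← ENNReal.ofReal_mul (by positivity), ← ENNReal.ofReal_mul (by positivity)]
          have : (2 : ℝ) - 1 = 1 := by norm_num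
          rw [Real.Gamma_two, this, Real.rpow_one, Real.rpow_two]
          congr 1
          field_simp
    _ = _ := by
        rw [lintegral_const_mul _ hm', lintegral_gammaPDF_eq_one two_pos hq, mul_one]

/-- Two probability measures on `ℝ` whose exponential moments agree and are finite near `0` are
equal. -/
lemma ext_of_lintegral_exp {m m' : Measure ℝ} [IsProbabilityMeasure m] [IsProbabilityMeasure m']
    {δ : ℝ} (hδ : 0 < δ)
    (hfin : ∀ s, |s| < δ → ∫⁻ x, ENNReal.ofReal (Real.exp (s * x)) ∂m ≠ ⊤)
    (heq : ∀ s, |s| < δ → ∫⁻ x, ENNReal.ofReal (Real.exp (s * x)) ∂m =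
      ∫⁻ x, ENNReal.ofReal (Real.exp (s * x)) ∂m') : m = m' := by
  have key : ∀ (ρ : Measure ℝ) [IsProbabilityMeasure ρ],
      (∀ s, |s| < δ → ∫⁻ x, ENNReal.ofReal (Real.exp (s * x)) ∂ρ ≠ ⊤) →
      AnalyticOnNhd ℂ (complexMGF id ρ) {z | z.re ∈ Set.Ioo (-δ) δ} := by
    intro ρ _ h
    refine analyticOnNhd_complexMGF.mono fun z hz => ?_
    refine interior_maximal (t := Set.Ioo (-δ) δ) (fun s hs => ?_) isOpen_Ioo hz
    have h1 := h s (abs_lt.2 hs)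
    change Integrable (fun x => Real.exp (s * id x)) ρ
    refine ⟨by fun_prop, ?_⟩
    rw [hasFiniteIntegral_iff_ofReal (Filter.Eventually.of_forall fun x => (Real.exp_pos _).le)]
    exact h1.lt_top
  have hre : ∀ s : ℝ, |s| < δ → complexMGF id m s = complexMGF id m' s := by
    intro s hs
    rw [complexMGF_ofReal, complexMGF_ofReal, mgf, mgf,
      integral_eq_lintegral_of_nonneg_ae (Filter.Eventually.of_forall fun x => (Real.exp_pos _).le)
        (by fun_prop),
      integral_eq_lintegral_of_nonneg_ae (Filter.Eventually.of_forall fun x => (Real.exp_pos _).le)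
        (by fun_prop)]
    simp only [id]
    rw [heq s hs]
  -- Both complex transforms are analytic on the strip `|Re z| < δ` and agree on its real segment.
  -- By the identity theorem they agree on the imaginary axis, where they are the characteristic
  -- functions.
  have hE := AnalyticOnNhd.eqOn_of_preconnected_of_frequently_eq (key m hfin)
    (key m' fun s hs => heq s hs ▸ hfin s hs)
    ((convex_Ioo (-δ) δ).linear_preimage Complex.reLm).isPreconnected
    (z₀ := 0) (by simp [hδ]) (by
      have h_real : ∃ᶠ x : ℝ in nhdsWithin 0 {0}ᶜ, complexMGF id m x = complexMGF id m' x := by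
        refine Filter.Eventually.frequently ?_
        refine nhdsWithin_le_nhds ?_
        filter_upwards [Ioo_mem_nhds (neg_lt_zero.2 hδ) hδ] with x hx using hre x (abs_lt.2 hx)
      refine Filter.Tendsto.frequently
        (f := fun x : ℝ => (x : ℂ)) (l₁ := nhdsWithin 0 {0}ᶜ) ?_ h_real
      refine tendsto_nhdsWithin_iff.2 ⟨?_, ?_⟩
      · exact (Complex.continuous_ofReal.tendsto' 0 0 (by simp)).mono_left nhdsWithin_le_nhds
      · filter_upwards [self_mem_nhdsWithin] with x hx
        simpa using hx)
  refine Measure.ext_of_charFun (funext fun t => ?_)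
  rw [← complexMGF_id_mul_I, ← complexMGF_id_mul_I]
  exact hE (by simp [hδ])

/-- **Tonelli's theorem** for a product of functions of one variable each. -/
lemma lintegral_pi_prod_eq_prod {ι : Type*} [Fintype ι] {E : ι → Type*}
    [∀ i, MeasurableSpace (E i)] {m : ∀ i, Measure (E i)} [∀ i, IsProbabilityMeasure (m i)]
    (f : ∀ i, E i → ENNReal) (hf : ∀ i, Measurable (f i)) :
    ∫⁻ x : (i : ι) → E i, ∏ i, f i (x i) ∂(Measure.pi m) = ∏ i, ∫⁻ x, f i x ∂(m i) := by
  rw [lintegral_prod_eq_prod_lintegral_of_indepFun Finset.univ (fun i (x : ∀ i, E i) => f i (x i))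
    (iIndepFun_pi fun i => (hf i).aemeasurable) fun i => (hf i).comp (measurable_pi_apply i)]
  exact Finset.prod_congr rfl fun i _ => (measurePreserving_eval m i).lintegral_comp (hf i)

end BirthDeath

/-! ### The embedded chain: path probabilities, conditional law of the waiting times, Markov
property. -/

namespace BirthDeath

/-- The sign conditions on the rates of a birth-death process on the positive integers. -/
structure IsRates (ν μ : ℕ → ℝ) : Prop where
  birth_pos : ∀ j, 1 ≤ j → 0 < ν j
  death_one : μ 1 = 0
  death_pos : ∀ j, 2 ≤ j → 0 < μ j

namespace IsRates

variable {ν μ : ℕ → ℝ} (h : IsRates ν μ)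
include h

lemma death_nonneg {j : ℕ} (hj : 1 ≤ j) : 0 ≤ μ j := by
  rcases hj.eq_or_lt with rfl | hj
  · exact h.death_one.ge
  · exact (h.death_pos j hj).le

lemma rate_pos {j : ℕ} (hj : 1 ≤ j) : 0 < μ j + ν j :=
  add_pos_of_nonneg_of_pos (h.death_nonneg hj) (h.birth_pos j hj)

lemma jumpProb_nonneg {i : ℕ} (hi : 1 ≤ i) (j : ℕ) : 0 ≤ jumpProb ν μ i j := by
  have h1 := h.death_nonneg hi
  have h2 := (h.birth_pos i hi).le
  unfold jumpProb
  split_ifs <;> positivity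

lemma jumpProb_zero {i : ℕ} (hi : 1 ≤ i) : jumpProb ν μ i 0 = 0 := by
  rw [jumpProb, if_neg (by omega)]
  split_ifs with h2
  · have : i = 1 := by omega
    simp [this, h.death_one]
  · rfl

omit h in
/-- The jump kernel acting on functions. -/
lemma tsum_jumpProb_mul {i : ℕ} (hi : 1 ≤ i) (f : ℕ → ENNReal) :
    ∑' j, ENNReal.ofReal (jumpProb ν μ i j) * f j =
      ENNReal.ofReal (ν i / (μ i + ν i)) * f (i + 1) +
        ENNReal.ofReal (μ i / (μ i + ν i)) * f (i - 1) := by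
  obtain ⟨k, rfl⟩ : ∃ k, i = k + 1 := ⟨i - 1, by omega⟩
  rw [tsum_eq_sum (s := {k + 1 + 1, k})]
  · rw [Finset.sum_pair (by omega)]
    have h1 : jumpProb ν μ (k + 1) k = μ (k + 1) / (μ (k + 1) + ν (k + 1)) := by
      rw [jumpProb, if_neg (by omega), if_pos rfl]
    rw [h1, jumpProb, if_pos rfl, Nat.add_sub_cancel]
  · intro j hj
    simp only [Finset.mem_insert, Finset.mem_singleton, not_or] at hj
    have : jumpProb ν μ (k + 1) j = 0 := by
      unfold jumpProb
      rw [if_neg hj.1, if_neg (by omega)]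
    simp [this]

lemma tsum_jumpProb {i : ℕ} (hi : 1 ≤ i) : ∑' j, ENNReal.ofReal (jumpProb ν μ i j) = 1 := by
  have h0 := tsum_jumpProb_mul (ν := ν) (μ := μ) hi 1
  simp only [Pi.one_apply, mul_one] at h0
  have h1 := h.death_nonneg hi
  have h2 := (h.birth_pos i hi)
  rw [h0, ← ENNReal.ofReal_add (by positivity) (by positivity), ← add_div, add_comm,
    div_self (h.rate_pos hi).ne', ENNReal.ofReal_one]

end IsRates

/-- The probability that the chain started at `1` follows the path `i` up to time `n`. -/
noncomputable def pathProb (ν μ : ℕ → ℝ) (n : ℕ) (i : ℕ → ℕ) : ℝ :=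
  (if i 0 = 1 then 1 else 0) * ∏ k ∈ Finset.range n, jumpProb ν μ (i k) (i (k + 1))

lemma pathProb_succ (ν μ : ℕ → ℝ) (n : ℕ) (i : ℕ → ℕ) :
    pathProb ν μ (n + 1) i = pathProb ν μ n i * jumpProb ν μ (i n) (i (n + 1)) := by
  rw [pathProb, pathProb, Finset.prod_range_succ, mul_assoc]

lemma pathProb_congr {ν μ : ℕ → ℝ} {n : ℕ} {i j : ℕ → ℕ} (h : ∀ k ≤ n, i k = j k) :
    pathProb ν μ n i = pathProb ν μ n j := by
  unfold pathProb
  rw [h 0 (Nat.zero_le _)]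
  congr 1
  refine Finset.prod_congr rfl fun k hk => ?_
  have := Finset.mem_range.1 hk
  rw [h k (by omega), h (k + 1) (by omega)]

namespace IsRates

variable {ν μ : ℕ → ℝ} (h : IsRates ν μ)
include h

/-- `IsRates` does not constrain the rates at `0`, so signs and exponential laws are available only
on states `≥ 1`. Paths of nonzero weight never leave them, because `μ 1 = 0`. -/
lemma one_le_of_pathProb_ne_zero {n : ℕ} {i : ℕ → ℕ} (hp : pathProb ν μ n i ≠ 0) :
    ∀ k ≤ n, 1 ≤ i k := by
  induction n with
  | zero =>
    intro k hk
    obtain rfl : k = 0 := by omega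
    by_contra h0
    refine hp ?_
    rw [pathProb, if_neg (by omega), zero_mul]
  | succ n ih =>
    rw [pathProb_succ] at hp
    have ih := ih (left_ne_zero_of_mul hp)
    intro k hk
    rcases Nat.le_succ_iff.1 hk with hk | rfl
    · exact ih k hk
    · by_contra h0
      refine right_ne_zero_of_mul hp ?_
      rw [Nat.lt_one_iff.1 (not_le.1 h0)]
      exact h.jumpProb_zero (ih n le_rfl)

lemma pathProb_nonneg (n : ℕ) (i : ℕ → ℕ) : 0 ≤ pathProb ν μ n i := by
  induction n with
  | zero => unfold pathProb; split_ifs <;> simp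
  | succ n ih =>
    rw [pathProb_succ]
    rcases ih.eq_or_lt with h0 | h0
    · simp [← h0]
    · exact mul_nonneg ih (h.jumpProb_nonneg (h.one_le_of_pathProb_ne_zero h0.ne' n le_rfl) _)

end IsRates

/-- The extension by `0` of a finite path. -/
def extendPath {n : ℕ} (z : Fin (n + 1) → ℕ) (k : ℕ) : ℕ :=
  if hk : k < n + 1 then z ⟨k, hk⟩ else 0

namespace MinimalProcess

variable {ν μ : ℕ → ℝ} {Ω : Type*} [MeasurableSpace Ω] {P : Measure Ω}

/-- The event that the chain follows the path `i` up to time `n`. -/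
def pathEvent (X : MinimalProcess ν μ 1 P) (n : ℕ) (i : ℕ → ℕ) : Set Ω :=
  {ω | ∀ k ≤ n, X.state k ω = i k}

variable (X : MinimalProcess ν μ 1 P)

lemma measurableSet_pathEvent (n : ℕ) (i : ℕ → ℕ) : MeasurableSet (X.pathEvent n i) := by
  simp only [pathEvent, Set.ofPred_forall]
  exact MeasurableSet.iInter fun k => MeasurableSet.iInter fun _ =>
    X.measurable_state k (measurableSet_singleton (i k))

lemma pathEvent_succ (n : ℕ) (i : ℕ → ℕ) :
    X.pathEvent (n + 1) i = X.pathEvent n i ∩ X.state (n + 1) ⁻¹' {i (n + 1)} := by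
  ext ω
  constructor
  · exact fun h => ⟨fun k hk => h k (by omega), h (n + 1) le_rfl⟩
  · rintro ⟨h1, h2⟩ k hk
    rcases Nat.le_succ_iff.1 hk with hk | rfl
    · exact h1 k hk
    · exact h2

lemma lintegral_eq_tsum_pathEvent (n : ℕ) (F : Ω → ENNReal) :
    ∫⁻ ω, F ω ∂P = ∑' z : Fin (n + 1) → ℕ, ∫⁻ ω in X.pathEvent n (extendPath z), F ω ∂P := by
  rw [← lintegral_iUnion (fun z => X.measurableSet_pathEvent n _)]
  · rw [Set.iUnion_eq_univ_iff.2, setLIntegral_univ]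
    intro ω
    refine ⟨fun k => X.state k ω, fun k hk => ?_⟩
    rw [extendPath, dif_pos (by omega)]
  · intro z z' hzz'
    refine Set.disjoint_left.2 fun ω hω hω' => hzz' (funext fun k => ?_)
    have h1 := hω k (by omega)
    have h2 := hω' k (by omega)
    simp only [extendPath, k.is_lt, dif_pos] at h1 h2
    rw [← h1, ← h2]

lemma setLIntegral_pathEvent_eq_tsum (n : ℕ) (i : ℕ → ℕ) (F : Ω → ENNReal) :
    ∫⁻ ω in X.pathEvent n i, F ω ∂P =
      ∑' j : ℕ, ∫⁻ ω in X.pathEvent (n + 1) (Function.update i (n + 1) j), F ω ∂P := by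
  rw [← lintegral_iUnion (fun z => X.measurableSet_pathEvent _ _)]
  · congr 2
    ext ω
    simp only [Set.mem_iUnion]
    constructor
    · intro hω
      refine ⟨X.state (n + 1) ω, ?_⟩
      rw [pathEvent_succ]
      refine ⟨fun k hk => ?_, by simp⟩
      rw [Function.update_of_ne (by omega)]
      exact hω k hk
    · rintro ⟨j, hj⟩ k hk
      have := hj k (by omega)
      rwa [Function.update_of_ne (by omega)] at this
  · intro j j' hj
    refine Set.disjoint_left.2 fun ω hω hω' => hj ?_
    have h1 := hω (n + 1) le_rfl
    have h2 := hω' (n + 1) le_rfl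
    simp only [Function.update_self] at h1 h2
    rw [← h1, ← h2]

variable [IsProbabilityMeasure P] (h : IsRates ν μ)
include h

lemma measure_pathEvent_inter_hold_gt (n : ℕ) (i : ℕ → ℕ) (s : ℕ → ℝ) (hs : ∀ k, 0 ≤ s k) :
    P (X.pathEvent n i ∩ {ω | ∀ k ≤ n, s k < X.hold k ω}) = ENNReal.ofReal (pathProb ν μ n i) *
      ∏ k ∈ Finset.range (n + 1), ENNReal.ofReal (Real.exp (-((μ (i k) + ν (i k)) * s k))) := by
  have hj := X.joint_law n i s hs
  rw [← ENNReal.ofReal_prod_of_nonneg fun k _ => (Real.exp_pos _).le,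
    ← ENNReal.ofReal_mul (h.pathProb_nonneg n i), pathProb, ← hj, ofReal_measureReal]
  congr 1
  ext ω
  simp only [pathEvent, Set.mem_inter_iff, Set.mem_ofPred_eq]
  exact ⟨fun H k hk => ⟨H.1 k hk, H.2 k hk⟩, fun H => ⟨fun k hk => (H k hk).1,
    fun k hk => (H k hk).2⟩⟩

lemma measure_pathEvent_inter_hold_pos (n : ℕ) (i : ℕ → ℕ) :
    P (X.pathEvent n i ∩ {ω | ∀ k ≤ n, 0 < X.hold k ω}) = ENNReal.ofReal (pathProb ν μ n i) := by
  simpa using X.measure_pathEvent_inter_hold_gt h n i 0 fun _ => le_rfl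

omit h [IsProbabilityMeasure P] in
lemma measurableSet_hold_pos (n : ℕ) : MeasurableSet {ω | ∀ k ≤ n, 0 < X.hold k ω} := by
  simp only [Set.ofPred_forall]
  exact MeasurableSet.iInter fun k => MeasurableSet.iInter fun _ =>
    measurableSet_lt measurable_const (X.measurable_hold k)

lemma tsum_pathProb_update (n : ℕ) (i : ℕ → ℕ) (f : ℕ → ENNReal) :
    ∑' j, ENNReal.ofReal (pathProb ν μ (n + 1) (Function.update i (n + 1) j)) * f j =
      ENNReal.ofReal (pathProb ν μ n i) * ∑' j, ENNReal.ofReal (jumpProb ν μ (i n) j) * f j := by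
  rw [← ENNReal.tsum_mul_left]
  refine tsum_congr fun j => ?_
  rw [pathProb_succ, pathProb_congr (j := i) fun k hk => Function.update_of_ne (by omega) _ _,
    ENNReal.ofReal_mul (h.pathProb_nonneg n i), Function.update_self,
    Function.update_of_ne (by omega), mul_assoc]

omit [IsProbabilityMeasure P] X in
lemma tsum_pathProb_update_one (n : ℕ) (i : ℕ → ℕ) :
    ∑' j, ENNReal.ofReal (pathProb ν μ (n + 1) (Function.update i (n + 1) j)) =
      ENNReal.ofReal (pathProb ν μ n i) := by
  have := tsum_pathProb_update h n i 1
  simp only [Pi.one_apply, mul_one] at this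
  rw [this]
  by_cases h0 : pathProb ν μ n i = 0
  · simp [h0]
  · rw [h.tsum_jumpProb (h.one_le_of_pathProb_ne_zero h0 n le_rfl), mul_one]

lemma tsum_pathProb (n : ℕ) :
    ∑' z : Fin (n + 1) → ℕ, ENNReal.ofReal (pathProb ν μ n (extendPath z)) =
      P {ω | ∀ k ≤ n, 0 < X.hold k ω} := by
  have := X.lintegral_eq_tsum_pathEvent n ({ω | ∀ k ≤ n, 0 < X.hold k ω}.indicator 1)
  rw [lintegral_indicator_one (X.measurableSet_hold_pos n)] at this
  rw [this]
  refine tsum_congr fun z => ?_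
  rw [← X.measure_pathEvent_inter_hold_pos h, lintegral_indicator_one (X.measurableSet_hold_pos n),
    Measure.restrict_apply (X.measurableSet_hold_pos n), Set.inter_comm]

/-- At thresholds `0` the joint law weighs paths only together with positivity of the waiting times.
The total weight of paths of length `n` does not depend on `n`, since jump probabilities sum to `1`,
and it is `1` for `n = 0`; so no mass is lost. -/
lemma measure_hold_pos (n : ℕ) : P {ω | ∀ k ≤ n, 0 < X.hold k ω} = 1 := by
  induction n with
  | zero =>
    rw [← X.tsum_pathProb h, tsum_eq_single (fun _ => 1)]
    · simp [pathProb, extendPath]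
    · intro z hz
      have : z 0 ≠ 1 := fun h0 => hz (funext fun k => by rw [Fin.fin_one_eq_zero k, h0])
      simp [pathProb, extendPath, this]
  | succ n ih =>
    rw [← ih, ← X.tsum_pathProb h n]
    have := X.lintegral_eq_tsum_pathEvent n ({ω | ∀ k ≤ n + 1, 0 < X.hold k ω}.indicator 1)
    rw [lintegral_indicator_one (X.measurableSet_hold_pos _)] at this
    rw [this]
    refine tsum_congr fun z => ?_
    rw [setLIntegral_pathEvent_eq_tsum, ← tsum_pathProb_update_one h]
    refine tsum_congr fun j => ?_
    rw [← X.measure_pathEvent_inter_hold_pos h,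
      lintegral_indicator_one (X.measurableSet_hold_pos _),
      Measure.restrict_apply (X.measurableSet_hold_pos _), Set.inter_comm]

lemma ae_hold_pos : ∀ᵐ ω ∂P, ∀ k, 0 < X.hold k ω := by
  refine ae_all_iff.2 fun k => ?_
  have := (prob_compl_eq_zero_iff (X.measurableSet_hold_pos k)).2 (X.measure_hold_pos h k)
  filter_upwards [compl_mem_ae_iff.2 this] with ω hω
  exact (not_not.1 hω) k le_rfl

lemma measure_pathEvent (n : ℕ) (i : ℕ → ℕ) :
    P (X.pathEvent n i) = ENNReal.ofReal (pathProb ν μ n i) := by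
  rw [← X.measure_pathEvent_inter_hold_pos h]
  refine measure_congr ?_
  filter_upwards [X.ae_hold_pos h] with ω hω
  exact propext ⟨fun H => ⟨H, fun k _ => hω k⟩, fun H => H.1⟩

/-- Given the path of the chain, the waiting times are independent and exponential. -/
lemma map_hold_restrict_pathEvent {n : ℕ} {i : ℕ → ℕ} (hi : ∀ k ≤ n, 1 ≤ i k) :
    (P.restrict (X.pathEvent n i)).map (fun ω (k : Fin (n + 1)) => X.hold k ω) =
      ENNReal.ofReal (pathProb ν μ n i) •
        Measure.pi fun k : Fin (n + 1) => expMeasure (μ (i k) + ν (i k)) := by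
  have hq : ∀ k : Fin (n + 1), 0 < μ (i k) + ν (i k) := fun k => h.rate_pos (hi k (by omega))
  have := fun k => isProbabilityMeasure_expMeasure (hq k)
  have hmeas : Measurable fun ω (k : Fin (n + 1)) => X.hold k ω :=
    measurable_pi_lambda _ fun k => X.measurable_hold k
  have hgen : (MeasurableSpace.pi : MeasurableSpace (Fin (n + 1) → ℝ)) =
      MeasurableSpace.generateFrom (Set.pi Set.univ '' Set.pi Set.univ
        fun _ : Fin (n + 1) => Set.range (Set.Ioi : ℝ → Set ℝ)) := by
    refine (generateFrom_eq_pi (fun _ => ?_) fun _ => ?_).symm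
    · rw [← borel_eq_generateFrom_Ioi, BorelSpace.measurable_eq (α := ℝ)]
    · refine ⟨fun m : ℕ => Set.Ioi (-(m : ℝ)), fun m => ⟨_, rfl⟩, ?_⟩
      refine Set.eq_univ_of_forall fun x => ?_
      obtain ⟨m, hm⟩ := exists_nat_gt (-x)
      exact Set.mem_iUnion.2 ⟨m, by simp; linarith⟩
  refine ext_of_generate_finite _ hgen (IsPiSystem.pi fun _ => isPiSystem_Ioi) ?_ ?_
  · rintro _ ⟨S, hS, rfl⟩
    choose s hs using fun k => hS k (Set.mem_univ k)
    obtain rfl : S = fun k => Set.Ioi (s k) := funext fun k => (hs k).symm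
    -- The joint law covers nonnegative thresholds only. Truncating at `0` changes the event by a
    -- null set, since the waiting times are almost surely positive.
    set s' : ℕ → ℝ := fun k => if hk : k < n + 1 then max (s ⟨k, hk⟩) 0 else 0 with hs'
    have hmS : MeasurableSet (Set.univ.pi fun k : Fin (n + 1) => Set.Ioi (s k)) :=
      MeasurableSet.univ_pi fun k => measurableSet_Ioi
    rw [Measure.map_apply hmeas hmS, Measure.restrict_apply (hmeas hmS), Measure.smul_apply,
      Measure.pi_pi, smul_eq_mul]
    have h1 := X.measure_pathEvent_inter_hold_gt h n i s' fun k => by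
      simp only [hs']; split_ifs <;> simp
    rw [← Fin.prod_univ_eq_prod_range
      (fun k => ENNReal.ofReal (Real.exp (-((μ (i k) + ν (i k)) * s' k)))) (n + 1)] at h1
    have h2 : ∀ k : Fin (n + 1), expMeasure (μ (i k) + ν (i k)) (Set.Ioi (s k)) =
        ENNReal.ofReal (Real.exp (-((μ (i k) + ν (i k)) * s' k))) := by
      intro k
      simp only [hs', k.is_lt, dif_pos]
      rcases le_total (s k) 0 with h0 | h0
      · rw [expMeasure_Ioi_of_neg (hq k) h0, max_eq_right h0]
        simp
      · rw [expMeasure_Ioi (hq k) h0, max_eq_left h0]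
    simp only [h2]
    rw [← h1]
    refine measure_congr ?_
    filter_upwards [X.ae_hold_pos h] with ω hω
    refine propext ⟨fun H => ⟨H.2, fun k hk => ?_⟩, fun H => ⟨fun k _ => ?_, H.1⟩⟩
    · simp only [hs', Nat.lt_succ_of_le hk, dif_pos]
      exact max_lt (H.1 ⟨k, Nat.lt_succ_of_le hk⟩ (Set.mem_univ _)) (hω k)
    · have := H.2 k (by omega)
      simp only [hs', k.is_lt, dif_pos] at this
      exact (le_max_left _ _).trans_lt this
  · rw [Measure.map_apply hmeas MeasurableSet.univ]
    simp [X.measure_pathEvent h]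

lemma setLIntegral_prod_hold (n : ℕ) (i : ℕ → ℕ) (g : ℕ → ℝ → ENNReal)
    (hg : ∀ k, Measurable (g k)) :
    ∫⁻ ω in X.pathEvent n i, ∏ k ∈ Finset.range (n + 1), g k (X.hold k ω) ∂P =
      ENNReal.ofReal (pathProb ν μ n i) *
        ∏ k ∈ Finset.range (n + 1), ∫⁻ x, g k x ∂expMeasure (μ (i k) + ν (i k)) := by
  by_cases hp : pathProb ν μ n i = 0
  · have : P.restrict (X.pathEvent n i) = 0 := by
      rw [Measure.restrict_eq_zero, X.measure_pathEvent h, hp, ENNReal.ofReal_zero]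
    simp [hp, this]
  have hi := h.one_le_of_pathProb_ne_zero hp
  have := fun k : Fin (n + 1) => isProbabilityMeasure_expMeasure (h.rate_pos (hi k (by omega)))
  have hmeas : Measurable fun ω (k : Fin (n + 1)) => X.hold k ω :=
    measurable_pi_lambda _ fun k => X.measurable_hold k
  have hm := X.map_hold_restrict_pathEvent h hi
  have h1 := lintegral_pi_prod_eq_prod
    (m := fun k : Fin (n + 1) => expMeasure (μ (i k) + ν (i k))) (fun k => g k) fun k => hg k
  rw [← Fin.prod_univ_eq_prod_range (fun k => ∫⁻ x, g k x ∂expMeasure (μ (i k) + ν (i k))), ← h1,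
    ← smul_eq_mul, ← lintegral_smul_measure, ← hm, lintegral_map _ hmeas]
  · simp only [← Fin.prod_univ_eq_prod_range (fun k => g k (X.hold k _))]
  · exact Finset.measurable_prod _ fun k _ => (hg _).comp (measurable_pi_apply k)

/-- The Markov property for multiplicative functionals of states and waiting times. -/
lemma lintegral_prod_mul_succ (n : ℕ) (g : ℕ → ℝ → ENNReal) (hg : ∀ x, Measurable (g x))
    (f : ℕ → ENNReal) :
    ∫⁻ ω, (∏ l ∈ Finset.range (n + 1), g (X.state l ω) (X.hold l ω)) *
        f (X.state (n + 1) ω) ∂P =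
      ∫⁻ ω, (∏ l ∈ Finset.range n, g (X.state l ω) (X.hold l ω)) *
        ((∫⁻ x, g (X.state n ω) x ∂expMeasure (μ (X.state n ω) + ν (X.state n ω))) *
          ∑' j, ENNReal.ofReal (jumpProb ν μ (X.state n ω) j) * f j) ∂P := by
  have hprod : ∀ (m : ℕ) (i : ℕ → ℕ), Measurable fun ω =>
      ∏ l ∈ Finset.range m, g (i l) (X.hold l ω) := fun m i =>
    Finset.measurable_prod _ fun k _ => (hg _).comp (X.measurable_hold k)
  have key : ∀ (m : ℕ) (i : ℕ → ℕ), ∫⁻ ω in X.pathEvent m i,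
      ∏ l ∈ Finset.range m, g (i l) (X.hold l ω) ∂P = ENNReal.ofReal (pathProb ν μ m i) *
        ∏ k ∈ Finset.range m, ∫⁻ x, g (i k) x ∂expMeasure (μ (i k) + ν (i k)) := by
    intro m i
    by_cases hp : pathProb ν μ m i = 0
    · have : P.restrict (X.pathEvent m i) = 0 := by
        rw [Measure.restrict_eq_zero, X.measure_pathEvent h, hp, ENNReal.ofReal_zero]
      simp [hp, this]
    have := isProbabilityMeasure_expMeasure
      (h.rate_pos (h.one_le_of_pathProb_ne_zero hp m le_rfl))
    -- A path up to time `m` carries `m + 1` waiting times; the last one gets the factor `1` and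
    -- integrates out.
    have h1 := X.setLIntegral_prod_hold h m i (fun k => if k < m then g (i k) else 1)
      (fun k => by split_ifs; exacts [hg _, measurable_const])
    simp only [Finset.prod_range_succ, lt_irrefl, if_false, Pi.one_apply, mul_one,
      lintegral_one, measure_univ] at h1
    rw [Finset.prod_congr rfl fun k hk => by rw [if_pos (Finset.mem_range.1 hk)]] at h1
    rw [← h1]
    refine lintegral_congr fun ω => Finset.prod_congr rfl fun k hk => ?_
    rw [if_pos (Finset.mem_range.1 hk)]
  rw [X.lintegral_eq_tsum_pathEvent n, X.lintegral_eq_tsum_pathEvent n]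
  refine tsum_congr fun z => ?_
  generalize extendPath z = i
  rw [setLIntegral_pathEvent_eq_tsum]
  trans ∑' j, ENNReal.ofReal (pathProb ν μ (n + 1) (Function.update i (n + 1) j)) *
    ((∏ k ∈ Finset.range (n + 1), ∫⁻ x, g (i k) x ∂expMeasure (μ (i k) + ν (i k))) * f j)
  · refine tsum_congr fun j => ?_
    set i' := Function.update i (n + 1) j with hi'
    have hii : ∀ k ∈ Finset.range (n + 1), i' k = i k := fun k hk =>
      Function.update_of_ne (Finset.mem_range.1 hk).ne _ _
    rw [← mul_assoc]
    have h3 : ∏ k ∈ Finset.range (n + 1), ∫⁻ x, g (i k) x ∂expMeasure (μ (i k) + ν (i k)) =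
        ∏ k ∈ Finset.range (n + 1), ∫⁻ x, g (i' k) x ∂expMeasure (μ (i' k) + ν (i' k)) :=
      Finset.prod_congr rfl fun k hk => by rw [hii k hk]
    rw [h3, ← key (n + 1) i', ← lintegral_mul_const _ (hprod _ _)]
    refine setLIntegral_congr_fun (X.measurableSet_pathEvent _ _) fun ω hω => ?_
    have h2 : X.state (n + 1) ω = j := by
      rw [hω (n + 1) le_rfl, hi', Function.update_self]
    simp only [h2]
    congr 1
    exact Finset.prod_congr rfl fun k hk => by rw [hω k (Finset.mem_range.1 hk).le]
  · rw [tsum_pathProb_update h, Finset.prod_range_succ]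
    simp_rw [mul_left_comm _ ((∏ k ∈ Finset.range n, _) * _)]
    rw [ENNReal.tsum_mul_left, ← mul_assoc, ← mul_assoc, ← key n i, mul_assoc,
      ← lintegral_mul_const _ (hprod _ _)]
    refine setLIntegral_congr_fun (X.measurableSet_pathEvent _ _) fun ω hω => ?_
    simp only [hω n le_rfl]
    congr 1
    exact Finset.prod_congr rfl fun k hk => by rw [hω k (Finset.mem_range.1 hk).le]

lemma ae_one_le_state : ∀ᵐ ω ∂P, ∀ k, 1 ≤ X.state k ω := by
  refine ae_all_iff.2 fun n => ?_
  have h1 := X.lintegral_eq_tsum_pathEvent n ({ω | X.state n ω = 0}.indicator 1)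
  have hm : MeasurableSet {ω | X.state n ω = 0} :=
    X.measurable_state n (measurableSet_singleton 0)
  rw [lintegral_indicator_one hm, ENNReal.tsum_eq_zero.2] at h1
  · filter_upwards [compl_mem_ae_iff.2 h1] with ω hω
    exact Nat.one_le_iff_ne_zero.2 hω
  · intro z
    rw [lintegral_indicator_one hm, Measure.restrict_apply hm]
    by_cases hp : pathProb ν μ n (extendPath z) = 0
    · exact measure_inter_null_of_null_right _ (by rw [X.measure_pathEvent h, hp]; simp)
    · have := h.one_le_of_pathProb_ne_zero hp n le_rfl
      convert measure_empty (μ := P)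
      ext ω
      simp only [Set.mem_inter_iff, Set.mem_ofPred_eq, Set.mem_empty_iff_false, iff_false]
      rintro ⟨h2, h3⟩
      rw [h3 n le_rfl] at h2
      omega

lemma ae_state_zero : ∀ᵐ ω ∂P, X.state 0 ω = 1 := by
  have h1 := X.measure_pathEvent h 0 fun _ => 1
  have h2 : P (X.pathEvent 0 fun _ => 1)ᶜ = 0 :=
    (prob_compl_eq_zero_iff (X.measurableSet_pathEvent _ _)).2 (by rw [h1]; simp [pathProb])
  filter_upwards [compl_mem_ae_iff.2 h2] with ω hω
  exact (not_not.1 hω) 0 le_rfl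

end MinimalProcess

end BirthDeath

/-! ### Occupation times, the Feynman-Kac identities and transience. -/

namespace BirthDeath

namespace MinimalProcess

variable {ν μ : ℕ → ℝ} {Ω : Type*} [MeasurableSpace Ω] {P : Measure Ω}
variable (X : MinimalProcess ν μ 1 P)

lemma jumpTime_succ (k : ℕ) (ω : Ω) : X.jumpTime (k + 1) ω = X.jumpTime k ω + X.hold k ω :=
  Finset.sum_range_succ _ _

lemma measurable_jumpTime (k : ℕ) : Measurable (X.jumpTime k) :=
  Finset.measurable_sum _ fun l _ => X.measurable_hold l

lemma monotone_jumpTime {ω : Ω} (hω : ∀ k, 0 < X.hold k ω) : Monotone fun k => X.jumpTime k ω :=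
  monotone_nat_of_le_succ fun k => by rw [jumpTime_succ]; linarith [hω k]

lemma jumpTime_nonneg {ω : Ω} (hω : ∀ k, 0 < X.hold k ω) (k : ℕ) : 0 ≤ X.jumpTime k ω :=
  Finset.sum_nonneg fun l _ => (hω l).le

lemma eta_eq_coe_iff {ω : Ω} (hω : ∀ k, 0 < X.hold k ω) (t : ℝ) (n : ℕ) :
    X.eta t ω = (n : WithTop ℕ) ↔
      ∃ k, X.state k ω = n ∧ t ∈ Set.Ico (X.jumpTime k ω) (X.jumpTime (k + 1) ω) := by
  classical
  unfold eta
  split_ifs with h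
  · rw [Nat.cast_inj]
    refine ⟨fun h1 => ⟨_, h1, Nat.find_spec h⟩, fun ⟨k, h1, h2⟩ => ?_⟩
    have h3 := Nat.find_spec h
    have hmono := X.monotone_jumpTime hω
    suffices Nat.find h = k by rw [this, h1]
    by_contra hne
    rcases Nat.lt_or_gt_of_ne hne with hlt | hlt
    · have : X.jumpTime (Nat.find h + 1) ω ≤ X.jumpTime k ω := hmono hlt
      linarith [h2.1, h3.2]
    · have : X.jumpTime (k + 1) ω ≤ X.jumpTime (Nat.find h) ω := hmono hlt
      linarith [h2.2, h3.1]
  · refine ⟨fun h1 => (WithTop.coe_ne_top h1.symm).elim, fun ⟨k, _, h2⟩ => (h ⟨k, h2⟩).elim⟩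

/-- The total waiting time of the visits to `n`. -/
noncomputable def occupation (n : ℕ) (ω : Ω) : ENNReal :=
  ∑' k, if X.state k ω = n then ENNReal.ofReal (X.hold k ω) else 0

lemma measurable_occupation (n : ℕ) : Measurable (X.occupation n) :=
  Measurable.tsum fun k => Measurable.ite (X.measurable_state k (measurableSet_singleton n))
    (X.measurable_hold k).ennreal_ofReal measurable_const

lemma totalTime_eq_occupation {ω : Ω} (hω : ∀ k, 0 < X.hold k ω) (n : ℕ) :
    X.totalTime n ω = X.occupation n ω := by
  have hset : {t : ℝ | 0 ≤ t ∧ X.eta t ω = (n : WithTop ℕ)} =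
      ⋃ k, if X.state k ω = n then Set.Ico (X.jumpTime k ω) (X.jumpTime (k + 1) ω) else ∅ := by
    ext t
    simp only [Set.mem_ofPred_eq, X.eta_eq_coe_iff hω, Set.mem_iUnion]
    constructor
    · rintro ⟨-, k, h1, h2⟩
      exact ⟨k, by rwa [if_pos h1]⟩
    · rintro ⟨k, hk⟩
      split_ifs at hk with h1
      · exact ⟨(X.jumpTime_nonneg hω k).trans hk.1, k, h1, hk⟩
      · exact hk.elim
  rw [totalTime, hset, measure_iUnion]
  · refine tsum_congr fun k => ?_
    split_ifs
    · rw [Real.volume_Ico, jumpTime_succ, add_sub_cancel_left]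
    · exact measure_empty
  · have hd := (X.monotone_jumpTime hω).pairwise_disjoint_on_Ico_succ
    intro k l hkl
    have := hd hkl
    simp only [Function.onFun] at this ⊢
    split_ifs <;> simp_all
  · intro k
    split_ifs
    exacts [measurableSet_Ico, MeasurableSet.empty]

lemma explosionTime_eq_tsum {ω : Ω} (hω : ∀ k, 0 < X.hold k ω) :
    X.explosionTime ω = ∑' k, ENNReal.ofReal (X.hold k ω) := by
  rw [explosionTime, ENNReal.tsum_eq_iSup_nat]
  refine iSup_congr fun k => ?_
  rw [jumpTime, ENNReal.ofReal_sum_of_nonneg fun l _ => (hω l).le]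

lemma explosionTime_eq_tsum_occupation {ω : Ω} (hω : ∀ k, 0 < X.hold k ω) :
    X.explosionTime ω = ∑' n, X.occupation n ω := by
  rw [X.explosionTime_eq_tsum hω]
  unfold occupation
  rw [ENNReal.tsum_comm]
  refine tsum_congr fun k => ?_
  rw [tsum_eq_single (X.state k ω)]
  · rw [if_pos rfl]
  · intro n hn
    rw [if_neg hn.symm]

section

variable [IsProbabilityMeasure P] (h : IsRates ν μ)
include h

/-- The condition `V x < μ x + ν x` makes the exponential moment finite. The right side equals `f x`
exactly when `L f x = -(V x * f x)`, which is how the Feynman-Kac formulas use it. -/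
lemma lintegral_jump_step_eq (V f : ℕ → ℝ) (hf : ∀ x, 0 ≤ f x) {x : ℕ} (hx : 1 ≤ x)
    (hV : V x < μ x + ν x) :
    (∫⁻ y, ENNReal.ofReal (Real.exp (V x * y)) ∂expMeasure (μ x + ν x)) *
        ∑' j, ENNReal.ofReal (jumpProb ν μ x j) * ENNReal.ofReal (f j) =
      ENNReal.ofReal ((ν x * f (x + 1) + μ x * f (x - 1)) / (μ x + ν x - V x)) := by
  have hq := h.rate_pos hx
  have h1 := (h.birth_pos x hx).le
  have h2 := h.death_nonneg hx
  have h3 := hf (x + 1)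
  have h4 := hf (x - 1)
  have h5 : 0 < μ x + ν x - V x := sub_pos.2 hV
  rw [lintegral_exp_expMeasure hq hV, IsRates.tsum_jumpProb_mul hx,
    ← ENNReal.ofReal_mul (by positivity), ← ENNReal.ofReal_mul (by positivity),
    ← ENNReal.ofReal_add (by positivity) (by positivity), ← ENNReal.ofReal_mul (by positivity)]
  congr 1
  field_simp

omit [IsProbabilityMeasure P] h in
lemma exp_sum_eq_prod (V : ℕ → ℝ) (n : ℕ) (ω : Ω) :
    ENNReal.ofReal (Real.exp (∑ l ∈ Finset.range n, V (X.state l ω) * X.hold l ω)) =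
      ∏ l ∈ Finset.range n, ENNReal.ofReal (Real.exp (V (X.state l ω) * X.hold l ω)) := by
  rw [Real.exp_sum, ENNReal.ofReal_prod_of_nonneg fun l _ => (Real.exp_pos _).le]

lemma lintegral_exp_mul_succ (V f : ℕ → ℝ) (hf : ∀ x, 0 ≤ f x)
    (hV : ∀ x, 1 ≤ x → V x < μ x + ν x) (n : ℕ) :
    ∫⁻ ω, ENNReal.ofReal (Real.exp (∑ l ∈ Finset.range (n + 1), V (X.state l ω) * X.hold l ω)) *
        ENNReal.ofReal (f (X.state (n + 1) ω)) ∂P =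
      ∫⁻ ω, ENNReal.ofReal (Real.exp (∑ l ∈ Finset.range n, V (X.state l ω) * X.hold l ω)) *
        ENNReal.ofReal ((ν (X.state n ω) * f (X.state n ω + 1) +
          μ (X.state n ω) * f (X.state n ω - 1)) /
            (μ (X.state n ω) + ν (X.state n ω) - V (X.state n ω))) ∂P := by
  simp_rw [exp_sum_eq_prod]
  rw [X.lintegral_prod_mul_succ h n (fun x y => ENNReal.ofReal (Real.exp (V x * y)))
    (fun x => by fun_prop) fun x => ENNReal.ofReal (f x)]
  refine lintegral_congr_ae ?_
  filter_upwards [X.ae_one_le_state h] with ω hω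
  rw [lintegral_jump_step_eq h V f hf (hω n) (hV _ (hω n))]

lemma lintegral_zero_time (V f : ℕ → ℝ) :
    ∫⁻ ω, ENNReal.ofReal (Real.exp (∑ l ∈ Finset.range 0, V (X.state l ω) * X.hold l ω)) *
        ENNReal.ofReal (f (X.state 0 ω)) ∂P = ENNReal.ofReal (f 1) := by
  rw [lintegral_congr_ae (g := fun _ => ENNReal.ofReal (f 1))]
  · simp
  · filter_upwards [X.ae_state_zero h] with ω hω
    simp [hω]

/-- Feynman-Kac bound for a supersolution. -/
lemma lintegral_exp_mul_le (V f : ℕ → ℝ) (hf : ∀ x, 0 ≤ f x)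
    (hV : ∀ x, 1 ≤ x → V x < μ x + ν x)
    (hL : ∀ x, 1 ≤ x → ν x * (f (x + 1) - f x) + μ x * (f (x - 1) - f x) ≤ -(V x * f x)) (n : ℕ) :
    ∫⁻ ω, ENNReal.ofReal (Real.exp (∑ l ∈ Finset.range n, V (X.state l ω) * X.hold l ω)) *
        ENNReal.ofReal (f (X.state n ω)) ∂P ≤ ENNReal.ofReal (f 1) := by
  induction n with
  | zero => exact (X.lintegral_zero_time h V f).le
  | succ n ih =>
    rw [X.lintegral_exp_mul_succ h V f hf hV]
    refine (lintegral_mono_ae ?_).trans ih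
    filter_upwards [X.ae_one_le_state h] with ω hω
    have h1 := hV _ (hω n)
    gcongr
    rw [div_le_iff₀ (by linarith)]
    linarith [hL _ (hω n)]

/-- Feynman-Kac formula. -/
lemma lintegral_exp_mul_eq (V f : ℕ → ℝ) (hf : ∀ x, 0 ≤ f x)
    (hV : ∀ x, 1 ≤ x → V x < μ x + ν x)
    (hL : ∀ x, 1 ≤ x → ν x * (f (x + 1) - f x) + μ x * (f (x - 1) - f x) = -(V x * f x)) (n : ℕ) :
    ∫⁻ ω, ENNReal.ofReal (Real.exp (∑ l ∈ Finset.range n, V (X.state l ω) * X.hold l ω)) *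
        ENNReal.ofReal (f (X.state n ω)) ∂P = ENNReal.ofReal (f 1) := by
  induction n with
  | zero => exact X.lintegral_zero_time h V f
  | succ n ih =>
    rw [X.lintegral_exp_mul_succ h V f hf hV, ← ih]
    refine lintegral_congr_ae ?_
    filter_upwards [X.ae_one_le_state h] with ω hω
    have h1 := hV _ (hω n)
    congr 2
    rw [div_eq_iff (by linarith)]
    linarith [hL _ (hω n)]

/-- If `n` has a finite potential, it is visited only finitely often. -/
lemma ae_eventually_state_ne {n : ℕ} (hn : 1 ≤ n) (f : ℕ → ℝ) (hf : ∀ x, 0 ≤ f x) {c : ℝ}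
    (hc : 0 < c)
    (hL : ∀ x, 1 ≤ x → ν x * (f (x + 1) - f x) + μ x * (f (x - 1) - f x) =
      if x = n then -c else 0) :
    ∀ᵐ ω ∂P, ∀ᶠ k in Filter.atTop, X.state k ω ≠ n := by
  have hmeas : ∀ k, MeasurableSet {ω | X.state k ω = n} := fun k =>
    X.measurable_state k (measurableSet_singleton n)
  have hmf : ∀ k, Measurable fun ω => ENNReal.ofReal (f (X.state k ω)) := fun k =>
    (measurable_of_countable fun x => ENNReal.ofReal (f x)).comp (X.measurable_state k)
  set e := ENNReal.ofReal (c / (μ n + ν n)) with he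
  have he0 : e ≠ 0 := by
    have := h.rate_pos hn
    rw [he, ne_eq, ENNReal.ofReal_eq_zero, not_le]
    positivity
  -- The potential loses `c / (μ n + ν n)` in conditional mean at each step from `n` and nothing
  -- elsewhere. Telescoping bounds the expected number of visits, and Borel-Cantelli concludes.
  have hstep : ∀ k, ∫⁻ ω, ENNReal.ofReal (f (X.state (k + 1) ω)) ∂P +
      e * P {ω | X.state k ω = n} = ∫⁻ ω, ENNReal.ofReal (f (X.state k ω)) ∂P := by
    intro k
    have h1 := X.lintegral_exp_mul_succ h 0 f hf (fun x hx => h.rate_pos hx) k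
    simp only [Pi.zero_apply, zero_mul, Finset.sum_const_zero, Real.exp_zero, ENNReal.ofReal_one,
      one_mul, sub_zero] at h1
    rw [h1, ← lintegral_indicator_one (hmeas k), ← lintegral_const_mul _
      (measurable_one.indicator (hmeas k)), ← lintegral_add_right _
      ((measurable_one.indicator (hmeas k)).const_mul _)]
    refine lintegral_congr_ae ?_
    filter_upwards [X.ae_one_le_state h] with ω hω
    have hx := hω k
    generalize hxk : X.state k ω = x at hx ⊢
    have hq := h.rate_pos hx
    have h2 := h.death_nonneg hx
    have h3 := (h.birth_pos x hx).le
    have h4 := hf (x + 1)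
    have h5 := hf (x - 1)
    have h6 := hL x hx
    by_cases hxn : x = n
    · rw [Set.indicator_of_mem (by simpa [hxk] using hxn)]
      rw [if_pos hxn] at h6
      rw [Pi.one_apply, mul_one, he, ← hxn, ← ENNReal.ofReal_add (by positivity) (by positivity)]
      congr 1
      field_simp
      linarith
    · rw [Set.indicator_of_notMem (by simpa [hxk] using hxn)]
      rw [if_neg hxn] at h6
      rw [mul_zero, add_zero]
      congr 1
      rw [div_eq_iff hq.ne']
      linarith
  have hsum : ∀ k, ∫⁻ ω, ENNReal.ofReal (f (X.state k ω)) ∂P +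
      ∑ l ∈ Finset.range k, e * P {ω | X.state l ω = n} = ENNReal.ofReal (f 1) := by
    intro k
    induction k with
    | zero =>
      have := X.lintegral_zero_time h 0 f
      simpa using this
    | succ k ih =>
      rw [← ih, ← hstep k, Finset.sum_range_succ, add_assoc, add_comm (∑ l ∈ _, _)]
  have hfin : e * ∑' k, P {ω | X.state k ω = n} ≤ ENNReal.ofReal (f 1) := by
    rw [← ENNReal.tsum_mul_left, ENNReal.tsum_eq_iSup_nat]
    exact iSup_le fun k => (hsum k).symm ▸ le_add_self
  refine ae_eventually_notMem (μ := P) (s := fun k => {ω | X.state k ω = n}) fun htop => ?_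
  rw [htop, ENNReal.mul_top he0, top_le_iff] at hfin
  exact ENNReal.ofReal_ne_top hfin

end

end MinimalProcess

end BirthDeath

/-! ### Tail sums, the potential of a state and the supersolution at rate `1 / r_∞`. -/

namespace BirthDeath

/-- The tail sums of a sequence. -/
noncomputable def tail (a : ℕ → ℝ) (x : ℕ) : ℝ := ∑' j, a (x + j)

/-- `ν j = c / a j` and `μ (j + 1) = c / a j` for `j ≥ 1`, with `∑ j a j` finite. -/
structure IsReciprocalRates (ν μ a : ℕ → ℝ) (c : ℝ) : Prop where
  pos : ∀ j, 1 ≤ j → 0 < a j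
  summable_mul : Summable fun n : ℕ => (n : ℝ) * a n
  c_pos : 0 < c
  birth : ∀ j, 1 ≤ j → ν j = c / a j
  death_one : μ 1 = 0
  death : ∀ j, 1 ≤ j → μ (j + 1) = c / a j

section Tail

variable {a : ℕ → ℝ} (hpos : ∀ j, 1 ≤ j → 0 < a j)
  (hsum : Summable fun n : ℕ => (n : ℝ) * a n)
include hpos hsum

lemma summable_of_summable_mul : Summable a := by
  refine (summable_nat_add_iff 1).1 ?_
  refine Summable.of_nonneg_of_le (fun n => (hpos _ (by omega)).le) (fun n => ?_)
    ((summable_nat_add_iff 1).2 hsum)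
  have h1 := hpos (n + 1) (by omega)
  push_cast
  have : (0 : ℝ) ≤ n := Nat.cast_nonneg n
  nlinarith

lemma summable_tail (x : ℕ) : Summable fun j => a (x + j) := by
  simpa [add_comm] using (summable_nat_add_iff x).2 (summable_of_summable_mul hpos hsum)

lemma tail_eq_add (x : ℕ) : tail a x = a x + tail a (x + 1) := by
  rw [tail, (summable_tail hpos hsum x).tsum_eq_zero_add, tail]
  simp only [add_zero, add_assoc, add_comm 1]

omit hsum in
lemma tail_nonneg {x : ℕ} (hx : 1 ≤ x) : 0 ≤ tail a x :=
  tsum_nonneg fun j => (hpos _ (by omega)).le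

lemma le_tail {x : ℕ} (hx : 1 ≤ x) : a x ≤ tail a x := by
  rw [tail_eq_add hpos hsum]
  linarith [tail_nonneg hpos (show 1 ≤ x + 1 by omega)]

lemma tail_pos {x : ℕ} (hx : 1 ≤ x) : 0 < tail a x := (hpos x hx).trans_le (le_tail hpos hsum hx)

lemma tail_antitone {x y : ℕ} (hx : 1 ≤ x) (hxy : x ≤ y) : tail a y ≤ tail a x := by
  induction y, hxy using Nat.le_induction with
  | base => exact le_rfl
  | succ y hxy ih =>
    refine le_trans ?_ ih
    rw [tail_eq_add hpos hsum y]
    linarith [hpos y (by omega)]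

omit hpos hsum in
lemma tendsto_tail (a : ℕ → ℝ) : Filter.Tendsto (tail a) Filter.atTop (nhds 0) := by
  have := tendsto_sum_nat_add a
  simpa [add_comm, tail] using! this

/-- Summation by parts. The boundary term is at most `∑_{j > N} j a j`, hence vanishes in the limit.
-/
lemma sum_range_tail (N : ℕ) : ∑ n ∈ Finset.range N, tail a (n + 1) =
    ∑ j ∈ Finset.range (N + 1), (j : ℝ) * a j + N * tail a (N + 1) := by
  induction N with
  | zero => simp
  | succ N ih =>
    rw [Finset.sum_range_succ, ih, Finset.sum_range_succ _ (N + 1), tail_eq_add hpos hsum (N + 1)]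
    push_cast
    ring

lemma hasSum_tail : HasSum (fun n => tail a (n + 1)) (∑' n : ℕ, (n : ℝ) * a n) := by
  rw [hasSum_iff_tendsto_nat_of_nonneg fun n => tail_nonneg hpos (by omega)]
  simp only [sum_range_tail hpos hsum]
  rw [← add_zero (∑' n : ℕ, (n : ℝ) * a n)]
  have hs := hsum.hasSum.tendsto_sum_nat.comp (Filter.tendsto_add_atTop_nat 1)
  have ht := (tendsto_tail fun n : ℕ => (n : ℝ) * a n).comp (Filter.tendsto_add_atTop_nat 1)
  refine hs.add (squeeze_zero (fun N => ?_) (fun N => ?_) ht)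
  · exact mul_nonneg (Nat.cast_nonneg N) (tail_nonneg hpos (by omega))
  · rw [tail, ← tsum_mul_left]
    refine Summable.tsum_le_tsum (fun j => ?_) ((summable_tail hpos hsum _).mul_left _) ?_
    · refine mul_le_mul_of_nonneg_right ?_ (hpos _ (by omega)).le
      push_cast
      have : (0 : ℝ) ≤ j := Nat.cast_nonneg j
      linarith
    · simpa [add_comm] using (summable_nat_add_iff (N + 1)).2 hsum

/-- Strictness comes from the second positive term `(x + 1) a (x + 1)`. It keeps the killing rate `c
/ r_∞` below every jump rate and makes `b` positive in `exists_supersolution`. -/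
lemma lt_tsum_mul {x : ℕ} (hx : 1 ≤ x) : a x < ∑' n : ℕ, (n : ℝ) * a n := by
  have h1 := hpos x hx
  have h2 := hpos (x + 1) (by omega)
  have h3 := hsum.sum_le_tsum {x, x + 1} fun n _ => by
    rcases Nat.eq_zero_or_pos n with rfl | hn
    · simp
    · have := hpos n hn
      positivity
  rw [Finset.sum_pair (by omega)] at h3
  have hx' : (1 : ℝ) ≤ x := by exact_mod_cast hx
  push_cast at h3
  nlinarith

/-- A supersolution, bounded away from `0`, for the critical killing rate `1 / ∑ n a n`. -/
lemma exists_supersolution : ∃ (f : ℕ → ℝ) (b : ℝ), 0 < b ∧ (∀ x, b ≤ f x) ∧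
    (f 2 - f 1) / a 1 ≤ -(f 1 / ∑' n : ℕ, (n : ℝ) * a n) ∧
    ∀ x, 1 ≤ x → (f (x + 2) - f (x + 1)) / a (x + 1) + (f x - f (x + 1)) / a x ≤
      -(f (x + 1) / ∑' n : ℕ, (n : ℝ) * a n) := by
  set R := ∑' n : ℕ, (n : ℝ) * a n with hR
  have hterm : ∀ n : ℕ, 0 ≤ (n : ℝ) * a n := fun n => by
    rcases Nat.eq_zero_or_pos n with rfl | hn
    · simp
    · have := hpos n hn
      positivity
  have h1 := hpos 1 le_rfl
  have hR1 : a 1 < R := lt_tsum_mul hpos hsum le_rfl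
  have hR0 : 0 < R := h1.trans hR1
  -- For `c = 1` this solves `L h = -1`, and `h ≤ R` makes it a supersolution. However, it tends to
  -- `0`, so it has to be lifted by a constant.
  set h : ℕ → ℝ := fun x => R - ∑ j ∈ Finset.range x, (j : ℝ) * a j with hh
  have hh0 : ∀ x, 0 ≤ h x := fun x => sub_nonneg.2 (hsum.sum_le_tsum _ fun n _ => hterm n)
  have hsucc : ∀ x, h (x + 1) = h x - x * a x := fun x => by
    simp only [hh, Finset.sum_range_succ]; ring
  have hone : h 1 = R := by simp [hh]
  have htwo : h 2 = R - a 1 := by rw [hsucc, hone]; simp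
  have hle : ∀ x, 2 ≤ x → h x ≤ R - a 1 := by
    intro x hx
    induction x, hx using Nat.le_induction with
    | base => exact htwo.le
    | succ x hx ih => rw [hsucc]; linarith [hterm x]
  -- Adding a constant `b` needs slack in `h ≤ R`, which is at least `a 1` for `x ≥ 2` but zero at
  -- `x = 1`. A bump `ε` at `1` lowers `L` there by `ε / a 1` and raises it by the same amount at
  -- `2` only. These values satisfy `ε + b = a 1 / 2`, giving equality at `1` and enough room
  -- elsewhere.
  set ε := a 1 ^ 2 / (2 * R) with hε
  set b := a 1 * (R - a 1) / (2 * R) with hb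
  have hb0 : 0 < b := div_pos (mul_pos h1 (sub_pos.2 hR1)) (by positivity)
  have hε0 : 0 < ε := by positivity
  refine ⟨fun x => h x + (if x = 1 then ε else 0) + b, b, hb0, fun x => ?_, ?_, fun x hx => ?_⟩
  · have := hh0 x
    dsimp only
    split_ifs <;> linarith
  · simp only [hone, htwo, if_true, OfNat.ofNat_ne_one, if_false]
    rw [hε, hb]
    field_simp
    nlinarith [mul_pos h1 hR0]
  · have hax := hpos x hx
    have hax1 := hpos (x + 1) (by omega)
    have e1 : h (x + 2) = h (x + 1) - ((x + 1 : ℕ) : ℝ) * a (x + 1) := hsucc (x + 1)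
    have e2 := hsucc x
    have h2 := hle (x + 1) (by omega)
    simp only [show x + 2 ≠ 1 by omega, show x + 1 ≠ 1 by omega, if_false]
    have e3 : (h (x + 2) + 0 + b - (h (x + 1) + 0 + b)) / a (x + 1) = -((x : ℝ) + 1) := by
      rw [e1]; push_cast; field_simp; ring
    have e4 : (h x + (if x = 1 then ε else 0) + b - (h (x + 1) + 0 + b)) / a x ≤ x + ε / a 1 := by
      rw [e2]
      split_ifs with hx1
      · subst hx1
        refine le_of_eq ?_
        field_simp
        ring
      · rw [div_le_iff₀ hax, add_mul]
        have : 0 ≤ ε / a 1 * a x := by positivity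
        linarith
    have e5 : (h (x + 1) + 0 + b) / R ≤ 1 - ε / a 1 := by
      rw [div_le_iff₀ hR0]
      have : (1 - ε / a 1) * R = R - a 1 / 2 := by rw [hε]; field_simp
      have hb' : b ≤ a 1 / 2 := by
        rw [hb, div_le_iff₀ (by positivity)]
        nlinarith [mul_pos h1 h1]
      linarith
    linarith

end Tail

namespace IsReciprocalRates

variable {ν μ a : ℕ → ℝ} {c : ℝ} (H : IsReciprocalRates ν μ a c)
include H

lemma death' {j : ℕ} (hj : 2 ≤ j) : μ j = c / a (j - 1) := by
  have := H.death (j - 1) (by omega)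
  rwa [Nat.sub_add_cancel (by omega)] at this

lemma isRates : IsRates ν μ where
  birth_pos j hj := by
    rw [H.birth j hj]
    exact div_pos H.c_pos (H.pos j hj)
  death_one := H.death_one
  death_pos j hj := by
    rw [H.death' hj]
    exact div_pos H.c_pos (H.pos _ (by omega))

lemma div_le_rate {j : ℕ} (hj : 1 ≤ j) : c / a j ≤ μ j + ν j := by
  rw [H.birth j hj]
  linarith [H.isRates.death_nonneg hj]

/-- The truncated tail is the potential of the state `n`. -/
lemma generator_tail_max {n : ℕ} (hn : 1 ≤ n) {x : ℕ} (hx : 1 ≤ x) :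
    ν x * (tail a (max (x + 1) n) - tail a (max x n)) +
      μ x * (tail a (max (x - 1) n) - tail a (max x n)) = if x = n then -c else 0 := by
  have ht := tail_eq_add H.pos H.summable_mul
  have hax := (H.pos x hx).ne'
  rcases lt_trichotomy x n with hlt | rfl | hlt
  · rw [max_eq_right (by omega), max_eq_right (by omega), max_eq_right (by omega), if_neg hlt.ne]
    ring
  · rw [max_eq_left (by omega), max_self, max_eq_right (by omega), if_pos rfl, H.birth x hx, ht x]
    field_simp
    ring
  · obtain ⟨y, rfl⟩ : ∃ y, x = y + 1 := ⟨x - 1, by omega⟩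
    have hay := (H.pos y (by omega)).ne'
    rw [max_eq_left (by omega), max_eq_left (by omega), Nat.add_sub_cancel,
      max_eq_left (by omega), if_neg (by omega), H.birth _ hx, H.death y (by omega), ht (y + 1),
      ht y, ht (y + 1)]
    field_simp
    ring

end IsReciprocalRates

end BirthDeath

/-! ### The exponential law of the occupation times and the bounds on the explosion time. -/

namespace BirthDeath

namespace MinimalProcess

variable {ν μ a : ℕ → ℝ} {c : ℝ} {Ω : Type*} [MeasurableSpace Ω] {P : Measure Ω}
  [IsProbabilityMeasure P] (X : MinimalProcess ν μ 1 P) (H : IsReciprocalRates ν μ a c)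
include H

lemma ae_tendsto_state : ∀ᵐ ω ∂P,
    Filter.Tendsto (fun k => X.state k ω) Filter.atTop Filter.atTop := by
  have h1 : ∀ᵐ ω ∂P, ∀ n, ∀ᶠ k in Filter.atTop, X.state k ω ≠ n + 1 := by
    refine ae_all_iff.2 fun n => ?_
    exact X.ae_eventually_state_ne H.isRates (by omega) (fun x => tail a (max x (n + 1)))
      (fun x => tail_nonneg H.pos (by omega)) H.c_pos
      fun x hx => H.generator_tail_max (by omega) hx
  filter_upwards [h1, X.ae_one_le_state H.isRates] with ω hω h0
  refine Filter.tendsto_atTop.2 fun n => ?_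
  have : ∀ᶠ k in Filter.atTop, ∀ m ∈ Finset.range n, X.state k ω ≠ m + 1 :=
    (Filter.eventually_all_finset _).2 fun m _ => hω m
  filter_upwards [this] with k hk
  by_contra hlt
  refine hk (X.state k ω - 1) (Finset.mem_range.2 ?_) ?_ <;> have := h0 k <;> omega

omit [IsProbabilityMeasure P] H in
lemma sum_potential_eq (s : ℝ) (n k : ℕ) (ω : Ω) :
    ∑ l ∈ Finset.range k, (if X.state l ω = n then s else 0) * X.hold l ω =
      s * ∑ l ∈ Finset.range k, if X.state l ω = n then X.hold l ω else 0 := by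
  rw [Finset.mul_sum]
  refine Finset.sum_congr rfl fun l _ => ?_
  split_ifs <;> simp

/-- The time spent in `n` is finite and the limit of the times spent there before the jumps. -/
lemma ae_occupation (n : ℕ) : ∀ᵐ ω ∂P, X.occupation n ω ≠ ⊤ ∧
    (∀ k, ∑ l ∈ Finset.range k, (if X.state l ω = n then X.hold l ω else 0) ≤
      (X.occupation n ω).toReal) ∧
    Filter.Tendsto (fun k => ∑ l ∈ Finset.range k, if X.state l ω = n then X.hold l ω else 0)
      Filter.atTop (nhds (X.occupation n ω).toReal) := by
  filter_upwards [X.ae_tendsto_state H, X.ae_hold_pos H.isRates] with ω hω hpos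
  set u : ℕ → ℝ := fun l => if X.state l ω = n then X.hold l ω else 0 with hu
  have hu0 : ∀ l, 0 ≤ u l := fun l => by
    simp only [hu]
    split_ifs
    exacts [(hpos l).le, le_rfl]
  have hsumm : Summable u := by
    obtain ⟨N, hN⟩ := Filter.eventually_atTop.1 (hω.eventually_gt_atTop n)
    refine summable_of_ne_finset_zero (s := Finset.range N) fun l hl => ?_
    have := hN l (by simpa using hl)
    exact if_neg this.ne'
  have hocc : X.occupation n ω = ENNReal.ofReal (∑' l, u l) := by
    rw [ENNReal.ofReal_tsum_of_nonneg hu0 hsumm, occupation]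
    refine tsum_congr fun l => ?_
    simp only [hu]
    split_ifs <;> simp
  rw [hocc, ENNReal.toReal_ofReal (tsum_nonneg hu0)]
  exact ⟨ENNReal.ofReal_ne_top, fun k => hsumm.sum_le_tsum _ fun l _ => hu0 l,
    hsumm.hasSum.tendsto_sum_nat⟩

/-- This range of `s` keeps `c - s r_n ≥ c / 2`, so the Feynman-Kac function `1 + s r_{max x n} / (c
- s r_n)` stays in `[0, 2]`. -/
lemma mul_tail_max_le {n : ℕ} (hn : 1 ≤ n) {s : ℝ} (hs : |s| < c / (2 * tail a n)) (x : ℕ) :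
    |s * tail a (max x n)| ≤ c / 2 := by
  have hc := H.c_pos
  have h1 := tail_pos H.pos H.summable_mul hn
  have h2 := tail_nonneg H.pos (show 1 ≤ max x n by omega)
  have h3 := tail_antitone H.pos H.summable_mul hn (le_max_right x n)
  rw [abs_mul, abs_of_nonneg h2]
  calc |s| * tail a (max x n) ≤ c / (2 * tail a n) * tail a n := by gcongr
    _ = c / 2 := by field_simp

/-- The Laplace transform of the time spent in `n` before the `k`-th jump. -/
lemma lintegral_exp_sum_occupation {n : ℕ} (hn : 1 ≤ n) {s : ℝ} (hs : |s| < c / (2 * tail a n))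
    (k : ℕ) :
    ∫⁻ ω, ENNReal.ofReal (Real.exp (s * ∑ l ∈ Finset.range k,
        if X.state l ω = n then X.hold l ω else 0)) *
      ENNReal.ofReal (1 + s * tail a (max (X.state k ω) n) / (c - s * tail a n)) ∂P =
    ENNReal.ofReal (c / (c - s * tail a n)) := by
  have hc := H.c_pos
  have hb := mul_tail_max_le H hn hs
  have hn' := hb n
  rw [max_self, abs_le] at hn'
  have hd : 0 < c - s * tail a n := by linarith
  have ht := tail_pos H.pos H.summable_mul hn
  have key := X.lintegral_exp_mul_eq H.isRates (fun x => if x = n then s else 0)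
    (fun x => 1 + s * tail a (max x n) / (c - s * tail a n)) (fun x => ?_) (fun x hx => ?_)
    (fun x hx => ?_) k
  · simp only [sum_potential_eq] at key
    rw [key, max_eq_right hn]
    congr 1
    field_simp
    ring
  · have := abs_le.1 (hb x)
    have h1 : -1 ≤ s * tail a (max x n) / (c - s * tail a n) := by
      rw [le_div_iff₀ hd]
      linarith
    linarith
  · split_ifs with hxn
    · rw [← hxn] at hs ht
      refine lt_of_lt_of_le ?_ (H.div_le_rate hx)
      have h1 := le_tail H.pos H.summable_mul hx
      have h2 := H.pos x hx
      calc s ≤ |s| := le_abs_self s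
        _ < c / (2 * tail a x) := hs
        _ ≤ c / a x := by gcongr; linarith
    · exact H.isRates.rate_pos hx
  · have h1 := H.generator_tail_max hn hx
    have h2 : ν x * (1 + s * tail a (max (x + 1) n) / (c - s * tail a n) -
          (1 + s * tail a (max x n) / (c - s * tail a n))) +
        μ x * (1 + s * tail a (max (x - 1) n) / (c - s * tail a n) -
          (1 + s * tail a (max x n) / (c - s * tail a n))) =
        s / (c - s * tail a n) * (ν x * (tail a (max (x + 1) n) - tail a (max x n)) +
          μ x * (tail a (max (x - 1) n) - tail a (max x n))) := by ring
    rw [h2, h1]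
    split_ifs with hxn
    · rw [hxn, max_self]
      field_simp
      ring
    · ring

omit [IsProbabilityMeasure P] H in
lemma measurable_sum_hold (n k : ℕ) : Measurable fun ω => ∑ l ∈ Finset.range k,
    if X.state l ω = n then X.hold l ω else 0 :=
  Finset.measurable_sum _ fun l _ => Measurable.ite
    (X.measurable_state l (measurableSet_singleton n)) (X.measurable_hold l) measurable_const

/-- For `s ≥ 0` the Feynman-Kac function is at least `1`, so the partial transforms are uniformly
bounded and Fatou's lemma applies. Applied to `|s|`, this supplies the dominating function for the
exact formula. -/
lemma lintegral_exp_occupation_ne_top {n : ℕ} (hn : 1 ≤ n) {s : ℝ} (hs0 : 0 ≤ s)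
    (hs : |s| < c / (2 * tail a n)) :
    ∫⁻ ω, ENNReal.ofReal (Real.exp (s * (X.occupation n ω).toReal)) ∂P ≠ ⊤ := by
  have hb := mul_tail_max_le H hn hs n
  rw [max_self, abs_le] at hb
  have hc := H.c_pos
  have hd : 0 < c - s * tail a n := by linarith
  have hk : ∀ k, ∫⁻ ω, ENNReal.ofReal (Real.exp (s * ∑ l ∈ Finset.range k,
      if X.state l ω = n then X.hold l ω else 0)) ∂P ≤ ENNReal.ofReal (c / (c - s * tail a n)) := by
    intro k
    rw [← X.lintegral_exp_sum_occupation H hn hs k]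
    refine lintegral_mono fun ω => ?_
    refine le_mul_of_one_le_right zero_le ?_
    rw [← ENNReal.ofReal_one]
    refine ENNReal.ofReal_le_ofReal ?_
    have := tail_nonneg H.pos (show 1 ≤ max (X.state k ω) n by omega)
    have : 0 ≤ s * tail a (max (X.state k ω) n) / (c - s * tail a n) := by positivity
    linarith
  have hm : ∀ k, Measurable fun ω => ENNReal.ofReal (Real.exp (s * ∑ l ∈ Finset.range k,
      if X.state l ω = n then X.hold l ω else 0)) := fun k =>
    ((X.measurable_sum_hold n k).const_mul s).exp.ennreal_ofReal
  have hF := lintegral_liminf_le (μ := P) (u := Filter.atTop) hm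
  refine ne_top_of_le_ne_top (ENNReal.ofReal_ne_top (r := c / (c - s * tail a n))) ?_
  calc _ = ∫⁻ ω, Filter.liminf (fun k => ENNReal.ofReal (Real.exp (s * ∑ l ∈ Finset.range k,
        if X.state l ω = n then X.hold l ω else 0))) Filter.atTop ∂P := by
        refine lintegral_congr_ae ?_
        filter_upwards [X.ae_occupation H n] with ω hω
        refine (Filter.Tendsto.liminf_eq ?_).symm
        exact ENNReal.tendsto_ofReal ((Real.continuous_exp.tendsto _).comp (hω.2.2.const_mul s))
    _ ≤ _ := hF
    _ ≤ _ := Filter.liminf_le_of_frequently_le' (Filter.Frequently.of_forall hk)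

lemma lintegral_exp_occupation {n : ℕ} (hn : 1 ≤ n) {s : ℝ} (hs : |s| < c / (2 * tail a n)) :
    ∫⁻ ω, ENNReal.ofReal (Real.exp (s * (X.occupation n ω).toReal)) ∂P =
      ENNReal.ofReal (c / (c - s * tail a n)) := by
  have hb := mul_tail_max_le H hn hs
  have hbn := hb n
  rw [max_self, abs_le] at hbn
  have hc := H.c_pos
  have hd : 0 < c - s * tail a n := by linarith
  -- The expectation is constant in `k`, while the factor `f (state k)` tends to `1` because the
  -- chain tends to infinity.
  have hlim := tendsto_lintegral_of_dominated_convergence' (μ := P)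
    (F := fun k ω => ENNReal.ofReal (Real.exp (s * ∑ l ∈ Finset.range k,
        if X.state l ω = n then X.hold l ω else 0)) *
      ENNReal.ofReal (1 + s * tail a (max (X.state k ω) n) / (c - s * tail a n)))
    (f := fun ω => ENNReal.ofReal (Real.exp (s * (X.occupation n ω).toReal)))
    (fun ω => ENNReal.ofReal (Real.exp (|s| * (X.occupation n ω).toReal)) * 2)
    (fun k => ?_) (fun k => ?_) ?_ ?_
  · simp only [X.lintegral_exp_sum_occupation H hn hs] at hlim
    exact tendsto_nhds_unique hlim tendsto_const_nhds
  · refine Measurable.aemeasurable (Measurable.mul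
      ((X.measurable_sum_hold n k).const_mul s).exp.ennreal_ofReal ?_)
    exact (measurable_of_countable fun x => ENNReal.ofReal
      (1 + s * tail a (max x n) / (c - s * tail a n))).comp (X.measurable_state k)
  · filter_upwards [X.ae_occupation H n, X.ae_hold_pos H.isRates] with ω hω hpos
    have h0 : 0 ≤ ∑ l ∈ Finset.range k, (if X.state l ω = n then X.hold l ω else 0) :=
      Finset.sum_nonneg fun l _ => by split_ifs; exacts [(hpos l).le, le_rfl]
    refine mul_le_mul' (ENNReal.ofReal_le_ofReal (Real.exp_le_exp.2 ?_)) ?_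
    · exact mul_le_mul (le_abs_self s) (hω.2.1 k) h0 (abs_nonneg s)
    · rw [← ENNReal.ofReal_ofNat 2]
      refine ENNReal.ofReal_le_ofReal ?_
      have h1 : s * tail a (max (X.state k ω) n) / (c - s * tail a n) ≤ 1 := by
        rw [div_le_one hd]
        linarith [(abs_le.1 (hb (X.state k ω))).2]
      linarith
  · rw [lintegral_mul_const' _ _ (by simp)]
    exact ENNReal.mul_ne_top (X.lintegral_exp_occupation_ne_top H hn (abs_nonneg s)
      (by rwa [abs_abs])) (by simp)
  · filter_upwards [X.ae_occupation H n, X.ae_tendsto_state H] with ω hω hst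
    have h1 : Filter.Tendsto (fun k => ENNReal.ofReal (Real.exp (s * ∑ l ∈ Finset.range k,
        if X.state l ω = n then X.hold l ω else 0))) Filter.atTop
        (nhds (ENNReal.ofReal (Real.exp (s * (X.occupation n ω).toReal)))) :=
      ENNReal.tendsto_ofReal ((Real.continuous_exp.tendsto _).comp (hω.2.2.const_mul s))
    have h2 : Filter.Tendsto (fun k => tail a (max (X.state k ω) n)) Filter.atTop (nhds 0) :=
      (tendsto_tail a).comp (Filter.tendsto_atTop_mono (fun k => le_max_left _ _) hst)
    have h3 : Filter.Tendsto (fun k => ENNReal.ofReal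
        (1 + s * tail a (max (X.state k ω) n) / (c - s * tail a n))) Filter.atTop (nhds 1) := by
      have := ENNReal.tendsto_ofReal (((h2.const_mul s).div_const (c - s * tail a n)).const_add 1)
      simpa using this
    simpa using ENNReal.Tendsto.mul h1 (Or.inr ENNReal.one_ne_top) h3 (Or.inr
      ENNReal.ofReal_ne_top)

/-- The time spent in a state is exponentially distributed. -/
lemma map_occupation_toReal {n : ℕ} (hn : 1 ≤ n) :
    P.map (fun ω => (X.occupation n ω).toReal) = expMeasure (c / tail a n) := by
  have hc := H.c_pos
  have ht := tail_pos H.pos H.summable_mul hn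
  have hq : 0 < c / tail a n := by positivity
  have hm : Measurable fun ω => (X.occupation n ω).toReal :=
    (X.measurable_occupation n).ennreal_toReal
  have := isProbabilityMeasure_expMeasure hq
  have := Measure.isProbabilityMeasure_map (μ := P) hm.aemeasurable
  have hcalc : ∀ s : ℝ, |s| < c / (2 * tail a n) →
      ∫⁻ x, ENNReal.ofReal (Real.exp (s * x)) ∂P.map (fun ω => (X.occupation n ω).toReal) =
        ENNReal.ofReal (c / (c - s * tail a n)) := fun s hs => by
    rw [lintegral_map (by fun_prop) hm, X.lintegral_exp_occupation H hn hs]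
  refine ext_of_lintegral_exp (δ := c / (2 * tail a n)) (by positivity) (fun s hs => ?_)
    fun s hs => ?_
  · rw [hcalc s hs]
    exact ENNReal.ofReal_ne_top
  · have hlt : s < c / tail a n := by
      refine ((le_abs_self s).trans_lt hs).trans_le ?_
      gcongr
      linarith
    rw [hcalc s hs, lintegral_exp_expMeasure hq hlt]
    have : 0 < c - s * tail a n := by
      rw [lt_div_iff₀ ht] at hlt
      linarith
    congr 1
    have h2 : c / tail a n - s = (c - s * tail a n) / tail a n := by field_simp
    rw [h2, div_div_div_cancel_right₀ ht.ne']

lemma hasLaw_occupation {n : ℕ} (hn : 1 ≤ n) :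
    HasLaw (X.occupation n) ((expMeasure (c / tail a n)).map ENNReal.ofReal) P where
  aemeasurable := (X.measurable_occupation n).aemeasurable
  map_eq := by
    rw [← X.map_occupation_toReal H hn, Measure.map_map (by fun_prop)
      (X.measurable_occupation n).ennreal_toReal]
    refine Measure.map_congr ?_
    filter_upwards [X.ae_occupation H n] with ω hω
    exact (ENNReal.ofReal_toReal hω.1).symm

lemma hasLaw_totalTime {n : ℕ} (hn : 1 ≤ n) :
    HasLaw (X.totalTime n) ((expMeasure (c / tail a n)).map ENNReal.ofReal) P := by
  refine (X.hasLaw_occupation H hn).congr ?_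
  filter_upwards [X.ae_hold_pos H.isRates] with ω hω using X.totalTime_eq_occupation hω n

lemma lintegral_occupation {n : ℕ} (hn : 1 ≤ n) :
    ∫⁻ ω, X.occupation n ω ∂P = ENNReal.ofReal (tail a n / c) := by
  have hc := H.c_pos
  have ht := tail_pos H.pos H.summable_mul hn
  have h1 := lintegral_map (μ := P) measurable_id (X.measurable_occupation n)
  simp only [id] at h1
  rw [← h1, (X.hasLaw_occupation H hn).map_eq,
    lintegral_map (f := fun x => x) measurable_id ENNReal.measurable_ofReal,
    lintegral_id_expMeasure (by positivity), one_div_div]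

lemma lintegral_totalTime {n : ℕ} (hn : 1 ≤ n) :
    ∫⁻ ω, X.totalTime n ω ∂P = ENNReal.ofReal (tail a n / c) := by
  rw [← X.lintegral_occupation H hn]
  refine lintegral_congr_ae ?_
  filter_upwards [X.ae_hold_pos H.isRates] with ω hω using X.totalTime_eq_occupation hω n

lemma lintegral_explosionTime :
    ∫⁻ ω, X.explosionTime ω ∂P = ENNReal.ofReal ((∑' n : ℕ, (n : ℝ) * a n) / c) := by
  have hc := H.c_pos
  have h1 : ∫⁻ ω, X.explosionTime ω ∂P = ∫⁻ ω, ∑' n, X.occupation (n + 1) ω ∂P := by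
    refine lintegral_congr_ae ?_
    filter_upwards [X.ae_hold_pos H.isRates, X.ae_one_le_state H.isRates] with ω hω h0
    have : X.occupation 0 ω = 0 := by
      refine ENNReal.tsum_eq_zero.2 fun k => if_neg ?_
      have := h0 k
      omega
    rw [X.explosionTime_eq_tsum_occupation hω,
      tsum_eq_zero_add' ENNReal.summable, this, zero_add]
  rw [h1, lintegral_tsum fun n => (X.measurable_occupation _).aemeasurable]
  have h2 := (hasSum_tail H.pos H.summable_mul).div_const c
  rw [← h2.tsum_eq, ENNReal.ofReal_tsum_of_nonneg
    (fun n => div_nonneg (tail_nonneg H.pos (by omega)) hc.le) h2.summable]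
  exact tsum_congr fun n => X.lintegral_occupation H (by omega)

lemma exp_le_measure_explosionTime {t : ℝ} (ht : 0 ≤ t) :
    Real.exp (-(c * t / tail a 1)) ≤ P.real {ω | ENNReal.ofReal t < X.explosionTime ω} := by
  have hc := H.c_pos
  have ht1 := tail_pos H.pos H.summable_mul le_rfl
  have h1 : P {ω | ENNReal.ofReal t < X.occupation 1 ω} =
      ENNReal.ofReal (Real.exp (-(c * t / tail a 1))) := by
    rw [(X.hasLaw_occupation H le_rfl).measure_eq (p := fun x => ENNReal.ofReal t < x)
      measurableSet_Ioi]
    change (expMeasure _).map ENNReal.ofReal (Set.Ioi (ENNReal.ofReal t)) = _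
    rw [Measure.map_apply ENNReal.measurable_ofReal measurableSet_Ioi]
    have h2 : ENNReal.ofReal ⁻¹' Set.Ioi (ENNReal.ofReal t) = Set.Ioi t := by
      ext x
      exact ENNReal.ofReal_lt_ofReal_iff_of_nonneg ht
    rw [h2, expMeasure_Ioi (by positivity) ht, div_mul_eq_mul_div]
  rw [← ENNReal.toReal_ofReal (Real.exp_pos _).le, ← h1]
  refine ENNReal.toReal_mono (measure_ne_top _ _) (measure_mono_ae ?_)
  filter_upwards [X.ae_hold_pos H.isRates] with ω hω h
  refine lt_of_lt_of_le h ?_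
  rw [X.explosionTime_eq_tsum_occupation hω]
  exact ENNReal.le_tsum 1

omit H in
/-- Exponential tails of the explosion time from a supersolution. -/
lemma measure_explosionTime_le (h : IsRates ν μ) {γ b : ℝ} {f : ℕ → ℝ} (hγ : 0 ≤ γ) (hb : 0 < b)
    (hf : ∀ x, b ≤ f x) (hγq : ∀ x, 1 ≤ x → γ < μ x + ν x)
    (hL : ∀ x, 1 ≤ x → ν x * (f (x + 1) - f x) + μ x * (f (x - 1) - f x) ≤ -(γ * f x)) (t : ℝ)
    (ht : 0 ≤ t) :
    P.real {ω | ENNReal.ofReal t < X.explosionTime ω} ≤ f 1 / b * Real.exp (-(γ * t)) := by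
  have hf1 : 0 ≤ f 1 := hb.le.trans (hf 1)
  set A : ℕ → Set Ω := fun k => {ω | t < X.jumpTime k ω} with hA
  have hmA : ∀ k, MeasurableSet (A k) := fun k =>
    measurableSet_lt measurable_const (X.measurable_jumpTime k)
  have hk : ∀ k, P (A k) ≤ ENNReal.ofReal (f 1 / b * Real.exp (-(γ * t))) := by
    intro k
    have h1 := X.lintegral_exp_mul_le h (fun _ => γ) f (fun x => hb.le.trans (hf x)) hγq hL k
    simp only [← Finset.mul_sum] at h1
    have h2 : ENNReal.ofReal (Real.exp (γ * t) * b) * P (A k) ≤ ENNReal.ofReal (f 1) := by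
      refine le_trans ?_ h1
      rw [← lintegral_indicator_const (hmA k)]
      refine lintegral_mono fun ω => ?_
      refine Set.indicator_apply_le' (fun hω => ?_) fun _ => zero_le
      rw [ENNReal.ofReal_mul (Real.exp_pos _).le]
      refine mul_le_mul' (ENNReal.ofReal_le_ofReal (Real.exp_le_exp.2 ?_))
        (ENNReal.ofReal_le_ofReal (hf _))
      exact mul_le_mul_of_nonneg_left (le_of_lt hω) hγ
    have h3 : 0 < Real.exp (γ * t) * b := by positivity
    rw [mul_comm, ← ENNReal.le_div_iff_mul_le (Or.inl (by simpa using h3))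
      (Or.inl ENNReal.ofReal_ne_top), ← ENNReal.ofReal_div_of_pos h3] at h2
    refine h2.trans (ENNReal.ofReal_le_ofReal (le_of_eq ?_))
    rw [Real.exp_neg]
    field_simp
  refine ENNReal.toReal_le_of_le_ofReal (by positivity) ?_
  -- Jump times are monotone only where the waiting times are positive; intersecting with that event
  -- makes the sets increase everywhere, as continuity from below requires.
  set B : ℕ → Set Ω := fun k => A k ∩ {ω | ∀ l, 0 < X.hold l ω} with hB
  have hBmono : Monotone B := fun k l hkl ω hω =>
    ⟨lt_of_lt_of_le hω.1 (X.monotone_jumpTime hω.2 hkl), hω.2⟩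
  calc P {ω | ENNReal.ofReal t < X.explosionTime ω} ≤ P (⋃ k, B k) := by
        refine measure_mono_ae ?_
        filter_upwards [X.ae_hold_pos h] with ω hω hlt
        obtain ⟨k, hk⟩ := lt_iSup_iff.1 (show ENNReal.ofReal t < ⨆ k, _ from hlt)
        exact Set.mem_iUnion.2 ⟨k, (ENNReal.ofReal_lt_ofReal_iff_of_nonneg ht).1 hk, hω⟩
    _ = ⨆ k, P (B k) := hBmono.measure_iUnion
    _ ≤ _ := iSup_le fun k => (measure_mono Set.inter_subset_left).trans (hk k)

end MinimalProcess

lemma isReciprocalRates {lam : ℕ → ℝ} (hlam : ∀ n, 1 ≤ n → 0 < lam n) {θ : ℝ}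
    (hr : Summable fun n : ℕ => (n : ℝ) * lam n ^ (-(2 * θ))) {σ : ℝ} (hσ : σ ≠ 0) :
    IsReciprocalRates (birthRate σ lam θ) (deathRate σ lam θ) (fun n => lam n ^ (-(2 * θ)))
      (σ ^ 2) where
  pos j hj := Real.rpow_pos_of_pos (hlam j hj) _
  summable_mul := hr
  c_pos := by positivity
  birth j hj := by rw [birthRate, Real.rpow_neg (hlam j hj).le, div_inv_eq_mul]
  death_one := by simp [deathRate]
  death j hj := by
    rw [deathRate, if_neg (by omega), Nat.add_sub_cancel, Real.rpow_neg (hlam j hj).le,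
      div_inv_eq_mul]

end BirthDeath

/-! ### Assembly of the main theorem. -/

theorem proposition4p4 (lam : ℕ → ℝ) (hlam : ∀ n, 1 ≤ n → 0 < lam n) (θ : ℝ)
    (hr : Summable fun n : ℕ => (n : ℝ) * lam n ^ (-(2 * θ))) :
    HasSum (fun n : ℕ => BirthDeath.tailSum lam θ (n + 1)) (BirthDeath.rInf lam θ) ∧
    ∃ α : ℝ, 0 < α ∧
      ∀ (σ : ℝ), σ ≠ 0 → ∀ (Ω : Type*) [MeasurableSpace Ω] (P : Measure Ω)
        [IsProbabilityMeasure P]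
        (X : BirthDeath.MinimalProcess (BirthDeath.birthRate σ lam θ)
          (BirthDeath.deathRate σ lam θ) 1 P),
        (∀ n : ℕ, 1 ≤ n →
          0 < BirthDeath.tailSum lam θ n ∧
          HasLaw (X.totalTime n)
            ((expMeasure (σ ^ 2 / BirthDeath.tailSum lam θ n)).map ENNReal.ofReal) P ∧
          ∫⁻ ω, X.totalTime n ω ∂P = ENNReal.ofReal (BirthDeath.tailSum lam θ n / σ ^ 2)) ∧
        ∫⁻ ω, X.explosionTime ω ∂P = ENNReal.ofReal (BirthDeath.rInf lam θ / σ ^ 2) ∧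
        ∀ t : ℝ, 0 ≤ t →
          Real.exp (-(σ ^ 2 * t / BirthDeath.tailSum lam θ 1)) ≤
              P.real {ω | ENNReal.ofReal t < X.explosionTime ω} ∧
            P.real {ω | ENNReal.ofReal t < X.explosionTime ω} ≤
              Real.exp (-(σ ^ 2 * t / BirthDeath.rInf lam θ) + α) := by
  set a : ℕ → ℝ := fun n => lam n ^ (-(2 * θ)) with ha
  have hpos : ∀ j, 1 ≤ j → 0 < a j := fun j hj => Real.rpow_pos_of_pos (hlam j hj) _
  have htail : ∀ n, BirthDeath.tailSum lam θ n = BirthDeath.tail a n := fun n => rfl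
  have hR : BirthDeath.rInf lam θ = ∑' n : ℕ, (n : ℝ) * a n := rfl
  simp only [htail, hR]
  refine ⟨BirthDeath.hasSum_tail hpos hr, ?_⟩
  obtain ⟨f, b, hb, hf, hf1, hf2⟩ := BirthDeath.exists_supersolution hpos hr
  have hRpos : ∀ x, 1 ≤ x → a x < ∑' n : ℕ, (n : ℝ) * a n := fun x hx =>
    BirthDeath.lt_tsum_mul hpos hr hx
  set R := ∑' n : ℕ, (n : ℝ) * a n
  have hR0 : 0 < R := (hpos 1 le_rfl).trans (hRpos 1 le_rfl)
  have hf10 : 0 < f 1 := hb.trans_le (hf 1)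
  -- `f` and `b` are built from `a` alone, before `σ` is introduced, so `α` does not depend on `σ`.
  -- The absolute value and the `+ 1` only ensure `α > 0`.
  refine ⟨|Real.log (f 1 / b)| + 1, by positivity, ?_⟩
  intro σ hσ Ω _ P _ X
  have H := BirthDeath.isReciprocalRates hlam hr hσ
  have hσ2 : 0 < σ ^ 2 := by positivity
  refine ⟨fun n hn => ⟨BirthDeath.tail_pos hpos hr hn, X.hasLaw_totalTime H hn,
    X.lintegral_totalTime H hn⟩, X.lintegral_explosionTime H, fun t ht =>
    ⟨X.exp_le_measure_explosionTime H ht, ?_⟩⟩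
  refine (X.measure_explosionTime_le H.isRates (γ := σ ^ 2 / R) (by positivity) hb hf
    (fun x hx => ?_) (fun x hx => ?_) t ht).trans ?_
  · refine lt_of_lt_of_le ?_ (H.div_le_rate hx)
    exact div_lt_div_of_pos_left hσ2 (hpos x hx) (hRpos x hx)
  · rw [H.birth x hx]
    rcases hx.eq_or_lt with rfl | hx
    · rw [H.death_one]
      have := mul_le_mul_of_nonneg_left hf1 hσ2.le
      calc _ = σ ^ 2 * ((f 2 - f 1) / a 1) := by ring
        _ ≤ _ := this
        _ = _ := by ring
    · obtain ⟨y, rfl⟩ : ∃ y, x = y + 1 := ⟨x - 1, by omega⟩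
      rw [H.death y (by omega), Nat.add_sub_cancel]
      have := mul_le_mul_of_nonneg_left (hf2 y (by omega)) hσ2.le
      calc _ = σ ^ 2 * ((f (y + 2) - f (y + 1)) / a (y + 1) + (f y - f (y + 1)) / a y) := by ring
        _ ≤ _ := this
        _ = _ := by ring
  · rw [add_comm, Real.exp_add, show σ ^ 2 * t / R = σ ^ 2 / R * t by ring]
    refine mul_le_mul_of_nonneg_right ?_ (Real.exp_pos _).le
    calc f 1 / b = Real.exp (Real.log (f 1 / b)) := (Real.exp_log (by positivity)).symm
      _ ≤ _ := Real.exp_le_exp.2 (by linarith [le_abs_self (Real.log (f 1 / b))])
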